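/- Let $p$ be a prime, $l\ge 1$ an integer and $d=p^l$. *Categories.* Let $\mathsf{ab}$ be the category of finitely generated free abelian groups, with objects labelled by their ranks: its objects are the integers $n\ge 0$, and a morphism $m\to n$ is a group homomorphism $\mathbb{Z}^m\to\mathbb{Z}^n$. Let $\mathcal{F}(\mathsf{ab};\mathbb{Z})$ be the category of functors from $\mathsf{ab}$ to the category $\mathsf{Ab}$ of abelian groups. Let $I\in\mathcal{F}(\mathsf{ab};\mathbb{Z})$ be the inclusion functor $n\mapsto\mathbb{Z}^n$, and $S^d\in\mathcal{F}(\mathsf{ab};\mathbb{Z})$ the $d$-th symmetric power functor $n\mapsto S^d(\mathbb{Z}^n)$. Write $e_1,\dots,e_n$ for the canonical basis of $\mathbb{Z}^n$. *Generators.* Let $\mathcal{G}$ consist of the morphisms $\tau:2\to2$, $(x,y)\mapsto(y,x)$; $\nabla:2\to1$, $(x,y)\mapsto x+y$; $\Delta:1\to2$, $x\mapsto(x,x)$; $\epsilon:1\to0$; $\eta:0\to1$; $S:1\to1$, $x\mapsto-x$. Let $\Gamma$ be the directed graph with vertex set $\mathbb{N}$ and with one edge ${}_n[f]_m$ from $n+s+m$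 to $n+t+m$ for every $f:s\to t$ in $\mathcal{G}$ and all $n,m\in\mathbb{N}$. Let $\mathcal{C}_\Gamma$ be the category freely generated by $\Gamma$, and $\pi:\mathcal{C}_\Gamma\to\mathsf{ab}$ the functor which is the identity on objects and sends ${}_n[f]_m$ to $\mathrm{id}_n\oplus f\oplus\mathrm{id}_m$. We also write $S^d$ and $I$ for $S^d\circ\pi$ and $I\circ\pi$. *The functor $E'_d$.* Let $E'_d:\mathcal{C}_\Gamma\to\mathsf{Ab}$ be the functor with $E'_d(s)=S^d(s)\oplus I(s)$ on objects and, on an edge $g:s\to t$, $$E'_d(g)=\begin{pmatrix}S^d(g)&D_d(g)\\0&I(g)\end{pmatrix},$$ where $D_d(g):I(s)\to S^d(t)$ is given as follows: - $D_d({}_n[\Delta]_m)(e_{n+1})=\sum_{k=1}^{d-1}\frac1p\binom{p^l}{k}e_{n+1}^k e_{n+2}^{d-k}$ and $D_d({}_n[\Delta]_m)(e_i)=0$ for $i\ne n+1$; - $D_d({}_n[S]_m)(e_{n+1})=\frac{1+(-1)^d}{p}e_{n+1}^d$ and $D_d({}_n[S]_m)(e_i)=0$ for $i\neq n+1$; -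 $D_d(g)=0$ for all other edges $g$. **Proposition.** The functor $E'_d$ factors through $\pi$: there is a unique functor $E_d\in\mathcal{F}(\mathsf{ab};\mathbb{Z})$ with $E_d\circ\pi=E'_d$. The inclusions $S^d(n)\to S^d(n)\oplus I(n)$ and the projections $S^d(n)\oplus I(n)\to I(n)$ form a short exact sequence $$0\to S^d\to E_d\to I\to0$$ in $\mathcal{F}(\mathsf{ab};\mathbb{Z})$. It is not split, its class generates the group $\mathrm{Ext}^1_{\mathcal{F}(\mathsf{ab};\mathbb{Z})}(I,S^d)$, and $\mathrm{Ext}^1_{\mathcal{F}(\mathsf{ab};\mathbb{Z})}(I,S^d)\cong\mathbb{Z}/p$. -/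

import Mathlib

open CategoryTheory CategoryTheory.Abelian

/-! ### The categories `ab` and `F(ab; ℤ)` -/

/-- Objects of `ab`: the object `n` stands for the free abelian group `ℤⁿ`. -/
@[ext] structure FreeAb where
  rank : ℕ

/-- The category `ab` of finitely generated free abelian groups, with its objects labelled by the
ranks (as in the `PROP` `ab`): a morphism `m ⟶ n` is a group homomorphism `ℤᵐ → ℤⁿ`. -/
instance : Category.{0} FreeAb where
  Hom m n := (Fin m.rank → ℤ) →+ (Fin n.rank → ℤ)
  id m := AddMonoidHom.id _
  comp f g := g.comp f

/-- The inclusion functor `I : ab ⥤ Ab`, `n ↦ ℤⁿ`. -/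
def inclFunctor : FreeAb ⥤ AddCommGrpCat.{0} where
  obj n := AddCommGrpCat.of (Fin n.rank → ℤ)
  map f := AddCommGrpCat.ofHom f

/-- The full subcategory of `Ab` on all finitely generated free abelian groups. -/
def isFinFree : ObjectProperty AddCommGrpCat.{0} :=
  fun A => Module.Free ℤ A ∧ Module.Finite ℤ A

/-- `I` takes values in finitely generated free abelian groups. -/
def toFinFree : FreeAb ⥤ isFinFree.FullSubcategory :=
  isFinFree.lift inclFunctor fun n =>
    ⟨inferInstanceAs (Module.Free ℤ (Fin n.rank → ℤ)),
      inferInstanceAs (Module.Finite ℤ (Fin n.rank → ℤ))⟩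

/-- `FreeAb` is equivalent to the category of all finitely generated free abelian groups. -/
theorem toFinFree_isEquivalence : toFinFree.IsEquivalence where
  faithful := ⟨fun {m n} f g h => by
    have h1 : inclFunctor.map f = inclFunctor.map g := congrArg (fun k => k.hom) h
    exact congrArg AddCommGrpCat.Hom.hom h1⟩
  full := ⟨fun {m n} f => ⟨AddCommGrpCat.Hom.hom f.hom, rfl⟩⟩
  essSurj := ⟨fun A => by
    obtain ⟨A, hfree, hfin⟩ := A
    refine ⟨⟨Module.finrank ℤ A⟩, ⟨isFinFree.isoMk ?_⟩⟩
    exact (Module.finBasis ℤ A).equivFun.symm.toAddEquiv.toAddCommGrpIso⟩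

/-- The category `F(ab; ℤ)` of functors from `ab` to abelian groups. -/
abbrev FunAb : Type 1 := FreeAb ⥤ AddCommGrpCat.{0}

instance : HasExt.{1} FunAb := HasExt.standard FunAb

/-! ### Symmetric powers -/

section SymmetricPowers

variable {M N P : Type} [AddCommGroup M] [AddCommGroup N] [AddCommGroup P]

/-- The `d`-th symmetric power of an abelian group `M`: the homogeneous part of degree `d` of the
symmetric algebra, i.e. the subgroup generated by all products of `d` elements of `M`. -/
def symPow (d : ℕ) (M : Type) [AddCommGroup M] : Submodule ℤ (SymmetricAlgebra ℤ M) :=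
  LinearMap.range (SymmetricAlgebra.ι ℤ M) ^ d

/-- The ring homomorphism of symmetric algebras induced by a group homomorphism. -/
noncomputable def symAlgMap (f : M →+ N) : SymmetricAlgebra ℤ M →ₐ[ℤ] SymmetricAlgebra ℤ N :=
  SymmetricAlgebra.lift (SymmetricAlgebra.ι ℤ N ∘ₗ f.toIntLinearMap)

theorem symAlgMap_id : symAlgMap (AddMonoidHom.id M) = AlgHom.id ℤ _ := by
  apply SymmetricAlgebra.algHom_ext
  ext x
  simp [symAlgMap]

theorem symAlgMap_comp (f : M →+ N) (g : N →+ P) :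
    symAlgMap (g.comp f) = (symAlgMap g).comp (symAlgMap f) := by
  apply SymmetricAlgebra.algHom_ext
  ext x
  simp [symAlgMap]

theorem symAlgMap_mem (d : ℕ) (f : M →+ N) {x : SymmetricAlgebra ℤ M} (hx : x ∈ symPow d M) :
    symAlgMap f x ∈ symPow d N := by
  have h : (symPow d M).map (symAlgMap f).toLinearMap ≤ symPow d N := by
    unfold symPow
    rw [Submodule.map_pow]
    refine pow_le_pow_left' ?_ d
    rintro _ ⟨_, ⟨y, rfl⟩, rfl⟩
    exact ⟨f y, by simp [symAlgMap]⟩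
  exact h ⟨x, hx, rfl⟩

/-- The homomorphism `S^d(f) : S^d(M) → S^d(N)`. -/
noncomputable def symPowMap (d : ℕ) (f : M →+ N) : symPow d M →+ symPow d N :=
  ((symAlgMap f).toLinearMap.restrict fun _ hx => symAlgMap_mem d f hx).toAddMonoidHom

theorem coe_symPowMap (d : ℕ) (f : M →+ N) (x : symPow d M) :
    (symPowMap d f x : SymmetricAlgebra ℤ N) = symAlgMap f x := rfl

theorem ι_pow_mul_ι_pow_mem (a b : ℕ) (x y : M) :
    SymmetricAlgebra.ι ℤ M x ^ a * SymmetricAlgebra.ι ℤ M y ^ b ∈ symPow (a + b) M := by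
  unfold symPow
  rw [pow_add]
  exact Submodule.mul_mem_mul (Submodule.pow_mem_pow _ (LinearMap.mem_range_self _ x) a)
    (Submodule.pow_mem_pow _ (LinearMap.mem_range_self _ y) b)

/-- The element `∑_{k=1}^{d-1} (1/p) (d choose k) x^k y^{d-k}` of `S^d(M)`, where `d = p^l`
(for `p` prime and `0 < k < d` the division by `p` is exact). -/
noncomputable def comulTwist (p l : ℕ) (x y : M) : symPow (p ^ l) M :=
  ⟨∑ k ∈ Finset.Icc 1 (p ^ l - 1), ((p ^ l).choose k / p) •
      (SymmetricAlgebra.ι ℤ M x ^ k * SymmetricAlgebra.ι ℤ M y ^ (p ^ l - k)),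
    Submodule.sum_mem _ fun k hk => by
      have hk' := Finset.mem_Icc.1 hk
      have h := ι_pow_mul_ι_pow_mem k (p ^ l - k) x y
      rw [show k + (p ^ l - k) = p ^ l by omega] at h
      exact Submodule.smul_of_tower_mem _ _ h⟩

/-- The element `((1 + (-1)^d) / p) x^d` of `S^d(M)`, where `d = p^l`
(for `p` prime and `l ≥ 1` the division by `p` is exact). -/
noncomputable def antipodeTwist (p l : ℕ) (x : M) : symPow (p ^ l) M :=
  ⟨((1 + (-1) ^ (p ^ l)) / (p : ℤ)) • SymmetricAlgebra.ι ℤ M x ^ (p ^ l),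
    Submodule.smul_mem _ _ (Submodule.pow_mem_pow _ (LinearMap.mem_range_self _ x) _)⟩

end SymmetricPowers

theorem comulTwist_exact {p : ℕ} (hp : p.Prime) {l k : ℕ} (h0 : 0 < k) (h1 : k < p ^ l) :
    p ∣ (p ^ l).choose k :=
  hp.dvd_choose_pow h0.ne' h1.ne

theorem antipodeTwist_exact {p : ℕ} (hp : p.Prime) {l : ℕ} (hl : 1 ≤ l) :
    (p : ℤ) ∣ 1 + (-1) ^ (p ^ l) := by
  rcases hp.eq_two_or_odd' with rfl | h
  · rw [Even.neg_one_pow ((even_two).pow_of_ne_zero (by omega))]; norm_num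
  · rw [Odd.neg_one_pow h.pow]; simp

/-- The symmetric power functor `S^d : ab ⥤ Ab`. -/
noncomputable def symFunctor (d : ℕ) : FunAb where
  obj n := AddCommGrpCat.of (symPow d (Fin n.rank → ℤ))
  map {m n} f :=
    AddCommGrpCat.ofHom (symPowMap (M := Fin m.rank → ℤ) (N := Fin n.rank → ℤ) d f)
  map_id n := by
    ext x
    exact DFunLike.congr_fun (symAlgMap_id (M := Fin n.rank → ℤ)) (x : SymmetricAlgebra ℤ _)
  map_comp {m n k} f g := by
    ext x
    exact DFunLike.congr_fun (symAlgMap_comp (M := Fin m.rank → ℤ) (N := Fin n.rank → ℤ)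
      (P := Fin k.rank → ℤ) f g) (x : SymmetricAlgebra ℤ _)

/-! ### The free category on the Hopf algebra generators -/

/-- The generators: symmetry, multiplication, comultiplication, counit, unit and antipode. -/
inductive HopfGen : ℕ → ℕ → Type
  | tau : HopfGen 2 2
  | mul : HopfGen 2 1
  | comul : HopfGen 1 2
  | counit : HopfGen 1 0
  | unit : HopfGen 0 1
  | antipode : HopfGen 1 1

/-- The homomorphism `ℤˢ → ℤᵗ` given by a generator. -/
def HopfGen.hom : {s t : ℕ} → HopfGen s t → ((Fin s → ℤ) →+ (Fin t → ℤ))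
  | _, _, .tau => AddMonoidHom.mk' (fun v => ![v 1, v 0]) fun a b => by
      funext i; fin_cases i <;> rfl
  | _, _, .mul => AddMonoidHom.mk' (fun v => ![v 0 + v 1]) fun a b => by
      funext i; fin_cases i; simp [add_add_add_comm]
  | _, _, .comul => AddMonoidHom.mk' (fun v => ![v 0, v 0]) fun a b => by
      funext i; fin_cases i <;> rfl
  | _, _, .counit => 0
  | _, _, .unit => 0
  | _, _, .antipode => AddMonoidHom.mk' (fun v => ![- v 0]) fun a b => by
      funext i; fin_cases i; simp [add_comm]

/-- The direct sum `f ⊕ g : ℤ^{a+c} → ℤ^{b+d}` of `f : ℤᵃ → ℤᵇ` and `g : ℤᶜ → ℤᵈ`. -/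
def homSum {a b c d : ℕ} (f : (Fin a → ℤ) →+ (Fin b → ℤ)) (g : (Fin c → ℤ) →+ (Fin d → ℤ)) :
    (Fin (a + c) → ℤ) →+ (Fin (b + d) → ℤ) :=
  AddMonoidHom.mk'
    (fun v => Fin.append (f fun i => v (Fin.castAdd c i)) (g fun i => v (Fin.natAdd a i)))
    fun v w => by
      have hf := f.map_add (fun i => v (Fin.castAdd c i)) (fun i => w (Fin.castAdd c i))
      have hg := g.map_add (fun i => v (Fin.natAdd a i)) (fun i => w (Fin.natAdd a i))
      funext i
      refine Fin.addCases (fun j => ?_) (fun j => ?_) i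
      · simp only [Fin.append_left, Pi.add_apply]
        exact congrFun hf j
      · simp only [Fin.append_right, Pi.add_apply]
        exact congrFun hg j

/-- Vertices of the graph `Γ`: the natural numbers. -/
structure GammaVertex where
  rank : ℕ

/-- Edges of the graph `Γ`: the edge `ₙ[f]ₘ : n + s + m ⟶ n + t + m`, for a generator
`f : s ⟶ t` and natural numbers `n`, `m`. -/
inductive GammaEdge : GammaVertex → GammaVertex → Type
  | mk {s t : ℕ} (n : ℕ) (f : HopfGen s t) (m : ℕ) : GammaEdge ⟨n + s + m⟩ ⟨n + t + m⟩

instance : Quiver.{0} GammaVertex := ⟨GammaEdge⟩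

/-- The category freely generated by the graph `Γ`. -/
abbrev CGamma : Type := Paths GammaVertex

/-- The homomorphism `id_n ⊕ f ⊕ id_m` named by the edge `ₙ[f]ₘ`. -/
def GammaEdge.hom : {a b : GammaVertex} → GammaEdge a b →
    ((Fin a.rank → ℤ) →+ (Fin b.rank → ℤ))
  | _, _, .mk n f m =>
      homSum (homSum (AddMonoidHom.id (Fin n → ℤ)) f.hom) (AddMonoidHom.id (Fin m → ℤ))

/-- The functor `C_Γ ⥤ ab` that interprets every edge as the morphism of `ab` it names. -/
def gammaToAb : CGamma ⥤ FreeAb :=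
  Paths.lift
    { obj := fun a => ⟨a.rank⟩
      map := fun {a b} (e : GammaEdge a b) => (e.hom : (⟨a.rank⟩ : FreeAb) ⟶ ⟨b.rank⟩) }

/-- The homomorphism `ℤⁿ⁺¹⁺ᵐ → A` with `e_{n+1} ↦ x` and `e_i ↦ 0` for `i ≠ n+1`
(the basis vectors are numbered from one here; the coordinate of `e_{n+1}` has index `n`). -/
def singleHom (n m : ℕ) {A : Type} [AddCommGroup A] (x : A) : (Fin (n + 1 + m) → ℤ) →+ A :=
  AddMonoidHom.mk' (fun v => v (Fin.castAdd m (Fin.natAdd n 0)) • x) fun v w => by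
    simp [add_smul]

/-- The twisting homomorphism `D_d(g) : I(a) → S^d(b)` of an edge `g : a ⟶ b`, `d = p^l`. -/
noncomputable def twist (p l : ℕ) : {a b : GammaVertex} → GammaEdge a b →
    ((Fin a.rank → ℤ) →+ symPow (p ^ l) (Fin b.rank → ℤ))
  | _, _, .mk n .antipode m =>
      singleHom n m (antipodeTwist p l (Pi.single (Fin.castAdd m (Fin.natAdd n 0)) 1))
  | _, _, .mk n .comul m =>
      singleHom n m (comulTwist p l
        (Pi.single (Fin.castAdd m (Fin.natAdd n 0)) 1)
        (Pi.single (Fin.castAdd m (Fin.natAdd n 1)) 1))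
  | _, _, .mk _ .tau _ => 0
  | _, _, .mk _ .mul _ => 0
  | _, _, .mk _ .counit _ => 0
  | _, _, .mk _ .unit _ => 0

/-- The functor `E'_d : C_Γ ⥤ Ab`, `d = p^l`: on objects `S^d ⊕ I`, and on an edge `g` the matrix
with rows `(S^d(g), D_d(g))` and `(0, I(g))`. -/
noncomputable def twistedFunctor (p l : ℕ) : CGamma ⥤ AddCommGrpCat.{0} :=
  Paths.lift
    { obj := fun a => AddCommGrpCat.of (symPow (p ^ l) (Fin a.rank → ℤ) × (Fin a.rank → ℤ))
      map := fun {a b} (e : GammaEdge a b) => AddCommGrpCat.ofHom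
        (((symPowMap (p ^ l) e.hom).coprod (twist p l e)).prod
          (e.hom.comp (AddMonoidHom.snd _ _))) }

/-!
Throughout `d = pˡ`, and `θ` (`frobLift`) denotes the homomorphism `ℤⁿ → Sᵈ(ℤⁿ)` with `eᵢ ↦ eᵢᵈ`.

**The functor.** The homomorphism `θ` is not natural in `n`, but modulo `p` it is the Frobenius
`v ↦ vᵈ`, which is. As `Sᵈ(ℤⁿ)` is torsion free, `D(f) = (Sᵈ(f) θ - θ f) / p` (`frobDefect`) is
therefore a well-defined homomorphism for every morphism `f` of `ab`; being `1/p` times a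
coboundary, it satisfies `D(g f) = Sᵈ(g) D(f) + D(g) f`, so that it defines a functor `E_d`
(`frobExtension`). Evaluating `D` on the generators gives the prescribed twists
(`frobDefect_edge`), hence `E_d ∘ π = E'_d`. Uniqueness holds because `π` is full
(`isGenerated`): the generators yield all permutations, transvections, and inclusions and
projections of direct summands, and `f` is `v ↦ (v, 0) ↦ (v, f v) ↦ (f v, v) ↦ f v`.

**The group `Ext¹(I, Sᵈ)`.** The central endomorphism `2` of `ab` acts on `I` as `2` and on `Sᵈ`
as `2ᵈ`, so `N = 2ᵈ - 2` annihilates `Ext¹(I, Sᵈ)`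
(`ext_inclFunctor_symFunctor_torsion`). The long exact sequence of `0 → Sᵈ → Sᵈ → Sᵈ/N → 0` then
presents every class as the image of a morphism `I → Sᵈ/N`. Such a morphism sends `e₁` to the class
of some `c e₁ᵈ`; additivity forces `N ∣ c (d choose k)` for `0 < k < d`, hence `N ∣ c p`, and the
morphism is annihilated by `p` (`p_smul_inclFunctor_hom`). So `p` annihilates `Ext¹(I, Sᵈ)`, and the
same long exact sequence with `p` in place of `N` shows that every class comes from a multiple of
the Frobenius `I → Sᵈ/p`. The image of the Frobenius is the class of `E_d`, because
`(x, v) ↦ p x + θ(v)` is a natural map `E_d → Sᵈ` (`exists_frobenius_extClass`). Therefore the class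
of `E_d` generates. It is not zero: a section `I → E_d` would send `e₁` to some `(c e₁ᵈ, e₁)`, and
additivity would give `p c + 1 = 0` (`frobExtensionSnd_no_section`).
-/

/-! ### Symmetric powers and binomial coefficients -/

open SymmetricAlgebra in
/-- A linear functional reading off the coefficient of `e₁ᵏ e₂ᵈ⁻ᵏ` in the symmetric algebra of
`ℤ²`. -/
theorem exists_binomialFunctional {d k : ℕ} (h0 : 0 < k) (h1 : k < d) :
    ∃ g : SymmetricAlgebra ℤ (Fin 2 → ℤ) →ₗ[ℤ] ℤ,
      g (ι ℤ (Fin 2 → ℤ) ![1, 0] ^ d) = 0 ∧ g (ι ℤ (Fin 2 → ℤ) ![0, 1] ^ d) = 0 ∧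
      g (ι ℤ (Fin 2 → ℤ) ![1, 1] ^ d) = d.choose k := by
  -- dehomogenise: `e₁ ↦ X`, `e₂ ↦ 1`
  let L : (Fin 2 → ℤ) →ₗ[ℤ] Polynomial ℤ :=
    (LinearMap.proj 0).smulRight (Polynomial.X : Polynomial ℤ) +
      (LinearMap.proj 1).smulRight (1 : Polynomial ℤ)
  refine ⟨Polynomial.lcoeff ℤ k ∘ₗ (lift L).toLinearMap, ?_, ?_, ?_⟩
  · simp [L, Polynomial.coeff_X_pow, h1.ne]
  · simp [L, Polynomial.coeff_one, h0.ne']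
  · simp [L, Polynomial.coeff_X_add_one_pow]

/-- The prime power binomial coefficients `(pˡ choose k)`, `0 < k < pˡ`, generate the ideal `(p)`:
already those with `k = 1` and `k = pˡ⁻¹` do. -/
theorem dvd_mul_prime_of_dvd_mul_choose {p l : ℕ} (hp : p.Prime) (hl : 1 ≤ l) {N c : ℤ}
    (h : ∀ k, 0 < k → k < p ^ l → N ∣ c * (p ^ l).choose k) : N ∣ c * p := by
  obtain ⟨u, v, huv⟩ : ∃ u v : ℤ,
      (p : ℤ) = u * (p ^ l).choose 1 + v * (p ^ l).choose (p ^ (l - 1)) := by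
    have hle : p ^ (l - 1) ≤ p ^ l := Nat.pow_le_pow_right hp.pos (Nat.sub_le l 1)
    have hfac : ((p ^ l).choose (p ^ (l - 1))).factorization p = 1 := by
      rw [Nat.factorization_choose_prime_pow hp hle (pow_pos hp.pos _).ne',
        hp.factorization_pow, Finsupp.single_eq_same]
      omega
    -- the gcd is a power of `p` and divides an integer of `p`-adic valuation one
    have hgcd : (p ^ l).gcd ((p ^ l).choose (p ^ (l - 1))) ∣ p := by
      obtain ⟨j, -, hj⟩ := (Nat.dvd_prime_pow hp).1
        (Nat.gcd_dvd_left (p ^ l) ((p ^ l).choose (p ^ (l - 1))))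
      have h2 := Nat.gcd_dvd_right (p ^ l) ((p ^ l).choose (p ^ (l - 1)))
      rw [hj] at h2 ⊢
      rw [hp.pow_dvd_iff_le_factorization (Nat.choose_pos hle).ne', hfac] at h2
      exact (pow_dvd_pow p h2).trans (pow_one p).dvd
    obtain ⟨u, v, huv⟩ := Int.gcd_dvd_iff.1
      (show Int.gcd ((p ^ l : ℕ) : ℤ) ((p ^ l).choose (p ^ (l - 1)) : ℕ) ∣ p by
        rwa [Int.gcd_natCast_natCast])
    exact ⟨u, v, by rw [huv, Nat.choose_one_right]; ring⟩
  have h1 : N ∣ c * (p ^ l).choose 1 := h 1 one_pos (Nat.one_lt_pow (by omega) hp.one_lt)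
  have h2 := h (p ^ (l - 1)) (pow_pos hp.pos _) (Nat.pow_lt_pow_right hp.one_lt (by omega))
  rw [huv, mul_add]
  exact dvd_add (by rw [mul_left_comm]; exact h1.mul_left u)
    (by rw [mul_left_comm]; exact h2.mul_left v)

section

variable {M N P : Type} [AddCommGroup M] [AddCommGroup N] [AddCommGroup P]

@[simp]
theorem symAlgMap_ι (f : M →+ N) (x : M) :
    symAlgMap f (SymmetricAlgebra.ι ℤ M x) = SymmetricAlgebra.ι ℤ N (f x) := by
  simp [symAlgMap]

/-- The power `xᵈ` as an element of `Sᵈ(M)`. -/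
noncomputable def symPowOf (d : ℕ) (x : M) : symPow d M :=
  ⟨SymmetricAlgebra.ι ℤ M x ^ d, Submodule.pow_mem_pow _ (LinearMap.mem_range_self _ x) d⟩

theorem coe_symPowOf (d : ℕ) (x : M) :
    (symPowOf d x : SymmetricAlgebra ℤ M) = SymmetricAlgebra.ι ℤ M x ^ d := rfl

theorem symPowMap_symPowOf (d : ℕ) (f : M →+ N) (x : M) :
    symPowMap d f (symPowOf d x) = symPowOf d (f x) := by
  apply Subtype.ext
  simp [coe_symPowMap, coe_symPowOf]

theorem symPowMap_id (d : ℕ) (x : symPow d M) : symPowMap d (AddMonoidHom.id M) x = x := by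
  apply Subtype.ext
  simp [coe_symPowMap, symAlgMap_id]

theorem symPowMap_comp (d : ℕ) (f : M →+ N) (g : N →+ P) (x : symPow d M) :
    symPowMap d (g.comp f) x = symPowMap d g (symPowMap d f x) := by
  apply Subtype.ext
  simp [coe_symPowMap, symAlgMap_comp]

theorem symAlgMap_zsmul_id (d : ℕ) (k : ℤ) (x : SymmetricAlgebra ℤ M) (hx : x ∈ symPow d M) :
    symAlgMap (k • AddMonoidHom.id M) x = k ^ d • x := by
  unfold symPow at hx
  induction hx using Submodule.pow_induction_on_left' with
  | algebraMap r => simp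
  | add x y i hx hy ihx ihy => rw [map_add, ihx, ihy, smul_add]
  | mem_mul m hm i x hx ih =>
    obtain ⟨y, rfl⟩ := hm
    rw [map_mul, ih, symAlgMap_ι]
    simp only [AddMonoidHom.smul_apply, AddMonoidHom.id_apply, map_zsmul, zsmul_eq_mul, pow_succ,
      Int.cast_mul, Int.cast_pow]
    ring

/-- Multiplication by `k` on `M` induces multiplication by `kᵈ` on `Sᵈ(M)`. -/
theorem symPowMap_zsmul_id (d : ℕ) (k : ℤ) (x : symPow d M) :
    symPowMap d (k • AddMonoidHom.id M) x = k ^ d • x := by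
  apply Subtype.ext
  exact symAlgMap_zsmul_id d k x.1 x.2

/-- If `M` is cyclic with generator `e`, then `Sᵈ(M)` is cyclic with generator `eᵈ`. -/
theorem exists_zsmul_symPowOf (d : ℕ) (e : M) (he : ∀ x : M, ∃ k : ℤ, x = k • e)
    (x : symPow d M) : ∃ c : ℤ, x = c • symPowOf d e := by
  have h : symPow d M ≤ Submodule.span ℤ {SymmetricAlgebra.ι ℤ M e ^ d} := by
    rw [← Set.singleton_pow, ← Submodule.span_pow]
    unfold symPow
    refine pow_le_pow_left' ?_ d
    rintro _ ⟨y, rfl⟩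
    obtain ⟨k, rfl⟩ := he y
    rw [map_zsmul]
    exact Submodule.smul_mem _ _ (Submodule.mem_span_singleton_self _)
  obtain ⟨c, hc⟩ := Submodule.mem_span_singleton.1 (h x.2)
  exact ⟨c, Subtype.ext hc.symm⟩

theorem p_smul_comulTwist {p : ℕ} (hp : p.Prime) (l : ℕ) (x y : M) :
    (p : ℤ) • comulTwist p l x y =
      symPowOf (p ^ l) (x + y) - symPowOf (p ^ l) x - symPowOf (p ^ l) y := by
  apply Subtype.ext
  obtain ⟨D, hD⟩ : ∃ D, p ^ l = D + 1 := ⟨p ^ l - 1, (Nat.sub_add_cancel (pow_pos hp.pos l)).symm⟩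
  have hD' : ∀ k, 0 < k → k < D + 1 → (p : ℤ) * ((D + 1).choose k / p : ℕ) = (D + 1).choose k := by
    intro k h0 h1
    rw [← hD] at h1 ⊢
    exact_mod_cast Nat.mul_div_cancel' (comulTwist_exact hp h0 h1)
  change (p : ℤ) • ∑ k ∈ Finset.Icc 1 (p ^ l - 1), _ = _ ^ _ - _ ^ _ - _ ^ _
  rw [hD, map_add, add_pow, Finset.sum_range_succ, Finset.range_eq_Ico,
    Finset.sum_eq_sum_Ico_succ_bot (Nat.succ_pos D), Finset.smul_sum]
  have hI : Finset.Icc 1 (D + 1 - 1) = Finset.Ico (0 + 1) (D + 1) := by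
    ext k; simp only [Finset.mem_Icc, Finset.mem_Ico]; omega
  rw [hI, Finset.sum_congr rfl (g := fun k => SymmetricAlgebra.ι ℤ M x ^ k *
    SymmetricAlgebra.ι ℤ M y ^ (D + 1 - k) * ((D + 1).choose k : ℕ))]
  · simp
  · intro k hk
    have hk := Finset.mem_Ico.1 hk
    rw [← natCast_zsmul, smul_smul, hD' k (by omega) hk.2]
    simp [mul_comm]

theorem p_smul_antipodeTwist {p : ℕ} (hp : p.Prime) {l : ℕ} (hl : 1 ≤ l) (x : M) :
    (p : ℤ) • antipodeTwist p l x = symPowOf (p ^ l) (-x) + symPowOf (p ^ l) x := by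
  apply Subtype.ext
  change (p : ℤ) • (((1 + (-1) ^ (p ^ l)) / (p : ℤ)) • SymmetricAlgebra.ι ℤ M x ^ (p ^ l)) =
    _ ^ _ + _ ^ _
  rw [smul_smul, Int.mul_ediv_cancel' (antipodeTwist_exact hp hl), map_neg,
    neg_pow (SymmetricAlgebra.ι ℤ M x), add_smul, one_smul, add_comm]
  simp

theorem symPowOf_zero {d : ℕ} (hd : d ≠ 0) : symPowOf d (0 : M) = 0 := by
  apply Subtype.ext
  simp [coe_symPowOf, hd]

end

/-- The homomorphism `ℤⁿ → Sᵈ(ℤⁿ)` with `eᵢ ↦ eᵢᵈ`. It is not natural in `n`, but it is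
natural modulo `p` if `d` is a power of the prime `p`. -/
noncomputable def frobLift (d n : ℕ) : (Fin n → ℤ) →+ symPow d (Fin n → ℤ) :=
  (Fintype.linearCombination ℤ fun i => symPowOf d (Pi.single i (1 : ℤ) : Fin n → ℤ)).toAddMonoidHom

theorem frobLift_apply (d n : ℕ) (v : Fin n → ℤ) :
    frobLift d n v = ∑ i, v i • symPowOf d (Pi.single i (1 : ℤ) : Fin n → ℤ) := rfl

theorem frobLift_single (d n : ℕ) (i : Fin n) :
    frobLift d n (Pi.single i 1) = symPowOf d (Pi.single i 1) := by
  rw [frobLift_apply, Finset.sum_eq_single i] <;> simp +contextual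

/-- Modulo `p`, the Frobenius `x ↦ xᵈ` is additive and fixes the integers. -/
theorem exists_symPowOf_sub_frobLift {p : ℕ} (hp : p.Prime) (l n : ℕ) (v : Fin n → ℤ) :
    ∃ y : symPow (p ^ l) (Fin n → ℤ),
      (p : ℤ) • y = symPowOf (p ^ l) v - frobLift (p ^ l) n v := by
  -- the vectors satisfying the claim form a subgroup, which contains the standard basis
  let H : AddSubgroup (Fin n → ℤ) :=
    { carrier := {v | ∃ y, (p : ℤ) • y = symPowOf (p ^ l) v - frobLift (p ^ l) n v}
      zero_mem' := ⟨0, by simp [symPowOf_zero (pow_pos hp.pos l).ne']⟩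
      add_mem' := by
        rintro v w ⟨y, hy⟩ ⟨z, hz⟩
        refine ⟨comulTwist p l v w + y + z, ?_⟩
        rw [smul_add, smul_add, p_smul_comulTwist hp, hy, hz, map_add]
        abel
      neg_mem' := by
        rintro v ⟨y, hy⟩
        refine ⟨-comulTwist p l v (-v) - y, ?_⟩
        rw [smul_sub, smul_neg, p_smul_comulTwist hp, hy, map_neg, add_neg_cancel,
          symPowOf_zero (pow_pos hp.pos l).ne']
        abel }
  change v ∈ H
  rw [← Finset.univ_sum_single v]
  refine H.sum_mem fun i _ => ?_
  rw [← mul_one (v i), ← smul_eq_mul, Pi.single_smul]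
  exact H.zsmul_mem ⟨0, by simp [frobLift_single]⟩ _

/-! ### The extension of the twist to all morphisms -/

theorem zsmul_symPow_injective {p : ℕ} (hp : p.Prime) {d n : ℕ} {x y : symPow d (Fin n → ℤ)}
    (h : (p : ℤ) • x = (p : ℤ) • y) : x = y :=
  smul_right_injective _ (Int.natCast_ne_zero.2 hp.ne_zero) h

/-- The Frobenius is natural modulo `p`. -/
theorem exists_frobLift_defect {p : ℕ} (hp : p.Prime) (l : ℕ) {m n : ℕ}
    (f : (Fin m → ℤ) →+ (Fin n → ℤ)) (v : Fin m → ℤ) :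
    ∃ y : symPow (p ^ l) (Fin n → ℤ), (p : ℤ) • y =
      symPowMap (p ^ l) f (frobLift (p ^ l) m v) - frobLift (p ^ l) n (f v) := by
  obtain ⟨y, hy⟩ := exists_symPowOf_sub_frobLift hp l m v
  obtain ⟨z, hz⟩ := exists_symPowOf_sub_frobLift hp l n (f v)
  refine ⟨z - symPowMap _ f y, ?_⟩
  rw [smul_sub, ← map_zsmul, hy, hz, map_sub, symPowMap_symPowOf]
  abel

/-- The homomorphism `D(f) = (Sᵈ(f) θ - θ f) / p : ℤᵐ → Sᵈ(ℤⁿ)` for an arbitrary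
`f : ℤᵐ → ℤⁿ`, where `θ` is `frobLift` and `d = pˡ`. It extends `twist` from the generating
edges to all morphisms of `ab`. -/
noncomputable def frobDefect {p : ℕ} (hp : p.Prime) (l : ℕ) {m n : ℕ}
    (f : (Fin m → ℤ) →+ (Fin n → ℤ)) : (Fin m → ℤ) →+ symPow (p ^ l) (Fin n → ℤ) :=
  AddMonoidHom.mk' (fun v => (exists_frobLift_defect hp l f v).choose) fun v w =>
    zsmul_symPow_injective hp <| by
      rw [smul_add, (exists_frobLift_defect hp l f v).choose_spec,
        (exists_frobLift_defect hp l f w).choose_spec,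
        (exists_frobLift_defect hp l f (v + w)).choose_spec, map_add, map_add, map_add, map_add]
      abel

theorem p_smul_frobDefect {p : ℕ} (hp : p.Prime) (l : ℕ) {m n : ℕ}
    (f : (Fin m → ℤ) →+ (Fin n → ℤ)) (v : Fin m → ℤ) :
    (p : ℤ) • frobDefect hp l f v =
      symPowMap (p ^ l) f (frobLift (p ^ l) m v) - frobLift (p ^ l) n (f v) :=
  (exists_frobLift_defect hp l f v).choose_spec

theorem frobDefect_id {p : ℕ} (hp : p.Prime) (l : ℕ) {n : ℕ} (v : Fin n → ℤ) :
    frobDefect hp l (AddMonoidHom.id (Fin n → ℤ)) v = 0 :=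
  zsmul_symPow_injective hp <| by
    rw [p_smul_frobDefect, symPowMap_id, AddMonoidHom.id_apply, sub_self, smul_zero]

theorem frobDefect_comp {p : ℕ} (hp : p.Prime) (l : ℕ) {m n k : ℕ}
    (f : (Fin m → ℤ) →+ (Fin n → ℤ)) (g : (Fin n → ℤ) →+ (Fin k → ℤ)) (v : Fin m → ℤ) :
    frobDefect hp l (g.comp f) v =
      symPowMap (p ^ l) g (frobDefect hp l f v) + frobDefect hp l g (f v) :=
  zsmul_symPow_injective hp <| by
    rw [smul_add, p_smul_frobDefect, p_smul_frobDefect, ← map_zsmul, p_smul_frobDefect,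
      symPowMap_comp, map_sub, AddMonoidHom.comp_apply]
    abel

/-- The homomorphism `Sᵈ(ℤᵐ) ⊕ ℤᵐ → Sᵈ(ℤⁿ) ⊕ ℤⁿ` with matrix rows `(Sᵈ(f), D)` and `(0, f)`. -/
noncomputable def twistedHom (d : ℕ) {m n : ℕ} (f : (Fin m → ℤ) →+ (Fin n → ℤ))
    (D : (Fin m → ℤ) →+ symPow d (Fin n → ℤ)) :
    symPow d (Fin m → ℤ) × (Fin m → ℤ) →+ symPow d (Fin n → ℤ) × (Fin n → ℤ) :=
  ((symPowMap d f).coprod D).prod (f.comp (AddMonoidHom.snd _ _))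

theorem twistedHom_apply (d : ℕ) {m n : ℕ} (f : (Fin m → ℤ) →+ (Fin n → ℤ))
    (D : (Fin m → ℤ) →+ symPow d (Fin n → ℤ)) (x : symPow d (Fin m → ℤ) × (Fin m → ℤ)) :
    twistedHom d f D x = (symPowMap d f x.1 + D x.2, f x.2) := rfl

/-- The functor `E_d : ab ⥤ Ab`, `d = pˡ`, with `E_d(n) = Sᵈ(ℤⁿ) ⊕ ℤⁿ` and
`E_d(f)(x, v) = (Sᵈ(f) x + D(f) v, f v)`. -/
noncomputable def frobExtension {p : ℕ} (hp : p.Prime) (l : ℕ) : FunAb where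
  obj n := AddCommGrpCat.of (symPow (p ^ l) (Fin n.rank → ℤ) × (Fin n.rank → ℤ))
  map {m n} f := AddCommGrpCat.ofHom
    (twistedHom (m := m.rank) (n := n.rank) (p ^ l) f (frobDefect hp l f))
  map_id n := by
    ext1
    refine DFunLike.ext _ _ fun x => ?_
    change twistedHom (p ^ l) (AddMonoidHom.id _) (frobDefect hp l (AddMonoidHom.id _)) x = x
    rw [twistedHom_apply, symPowMap_id, frobDefect_id, add_zero]
    rfl
  map_comp {m n k} f g := by
    ext1
    refine DFunLike.ext _ _ fun x => ?_
    change twistedHom (p ^ l) (AddMonoidHom.comp g f) (frobDefect hp l (AddMonoidHom.comp g f)) x =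
      twistedHom (p ^ l) g (frobDefect hp l g) (twistedHom (p ^ l) f (frobDefect hp l f) x)
    simp only [twistedHom_apply, symPowMap_comp, frobDefect_comp, map_add, AddMonoidHom.comp_apply,
      add_assoc]

theorem homSum_id_apply (n m : ℕ) {s t : ℕ} (f : (Fin s → ℤ) →+ (Fin t → ℤ))
    (v : Fin (n + s + m) → ℤ) :
    homSum (homSum (AddMonoidHom.id (Fin n → ℤ)) f) (AddMonoidHom.id (Fin m → ℤ)) v =
      Fin.append (Fin.append (fun i => v (Fin.castAdd m (Fin.castAdd s i)))
        (f fun i => v (Fin.castAdd m (Fin.natAdd n i)))) (fun i => v (Fin.natAdd (n + s) i)) :=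
  rfl

/-- The value of `idₙ ⊕ f ⊕ idₘ` on a basis vector outside the middle block. -/
theorem homSum_id_single_left (n m : ℕ) {s t : ℕ} (f : (Fin s → ℤ) →+ (Fin t → ℤ)) (i : Fin n) :
    homSum (homSum (AddMonoidHom.id (Fin n → ℤ)) f) (AddMonoidHom.id (Fin m → ℤ))
      (Pi.single (Fin.castAdd m (Fin.castAdd s i)) 1) =
      Pi.single (Fin.castAdd m (Fin.castAdd t i)) 1 := by
  have hmid : (fun j => (Pi.single (Fin.castAdd m (Fin.castAdd s i)) 1 : Fin (n + s + m) → ℤ)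
      (Fin.castAdd m (Fin.natAdd n j))) = 0 := by
    funext j
    refine Pi.single_eq_of_ne (fun h => ?_) _
    simp only [Fin.ext_iff, Fin.val_castAdd, Fin.val_natAdd] at h
    omega
  rw [homSum_id_apply, hmid, map_zero]
  funext k
  refine Fin.addCases (fun k => Fin.addCases (fun k => ?_) (fun k => ?_) k) (fun k => ?_) k <;>
    simp only [Fin.append_left, Fin.append_right, Pi.single_apply, Pi.zero_apply, Fin.ext_iff,
      Fin.val_castAdd, Fin.val_natAdd] <;> split_ifs <;> first | rfl | omega

theorem homSum_id_single_right (n m : ℕ) {s t : ℕ} (f : (Fin s → ℤ) →+ (Fin t → ℤ)) (i : Fin m) :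
    homSum (homSum (AddMonoidHom.id (Fin n → ℤ)) f) (AddMonoidHom.id (Fin m → ℤ))
      (Pi.single (Fin.natAdd (n + s) i) 1) = Pi.single (Fin.natAdd (n + t) i) 1 := by
  have hmid : (fun j => (Pi.single (Fin.natAdd (n + s) i) 1 : Fin (n + s + m) → ℤ)
      (Fin.castAdd m (Fin.natAdd n j))) = 0 := by
    funext j
    refine Pi.single_eq_of_ne (fun h => ?_) _
    simp only [Fin.ext_iff, Fin.val_castAdd, Fin.val_natAdd] at h
    omega
  rw [homSum_id_apply, hmid, map_zero]
  funext k
  refine Fin.addCases (fun k => Fin.addCases (fun k => ?_) (fun k => ?_) k) (fun k => ?_) k <;>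
    simp only [Fin.append_left, Fin.append_right, Pi.single_apply, Pi.zero_apply, Fin.ext_iff,
      Fin.val_castAdd, Fin.val_natAdd] <;> split_ifs <;> first | rfl | omega

/-- The inclusion of the middle block `ℤᵗ → ℤⁿ⁺ᵗ⁺ᵐ`. -/
def midIncl (n m t : ℕ) : (Fin t → ℤ) →+ (Fin (n + t + m) → ℤ) :=
  AddMonoidHom.mk' (fun w => Fin.append (Fin.append 0 w) 0) fun v w => by
    funext i
    refine Fin.addCases (fun j => Fin.addCases (fun j => ?_) (fun j => ?_) j) (fun j => ?_) i <;>
      simp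

theorem midIncl_single (n m t : ℕ) (i : Fin t) :
    midIncl n m t (Pi.single i 1) = Pi.single (Fin.castAdd m (Fin.natAdd n i)) 1 := by
  change Fin.append (Fin.append 0 _) 0 = _
  funext k
  refine Fin.addCases (fun k => Fin.addCases (fun k => ?_) (fun k => ?_) k) (fun k => ?_) k <;>
    simp only [Fin.append_left, Fin.append_right, Pi.single_apply, Pi.zero_apply, Fin.ext_iff,
      Fin.val_castAdd, Fin.val_natAdd] <;> split_ifs <;> first | rfl | omega

theorem homSum_id_midIncl (n m : ℕ) {s t : ℕ} (f : (Fin s → ℤ) →+ (Fin t → ℤ)) (w : Fin s → ℤ) :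
    homSum (homSum (AddMonoidHom.id (Fin n → ℤ)) f) (AddMonoidHom.id (Fin m → ℤ))
      (midIncl n m s w) = midIncl n m t (f w) := by
  rw [homSum_id_apply]
  change Fin.append (Fin.append (fun i => Fin.append (Fin.append 0 w) 0 _)
    (f fun i => Fin.append (Fin.append 0 w) 0 _)) (fun i => Fin.append (Fin.append 0 w) 0 _) =
    Fin.append (Fin.append 0 (f w)) 0
  simp only [Fin.append_left, Fin.append_right]

theorem addHom_pi_ext {n : ℕ} {A : Type} [AddCommGroup A] {f g : (Fin n → ℤ) →+ A}
    (h : ∀ i, f (Pi.single i 1) = g (Pi.single i 1)) : f = g := by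
  have : f.toIntLinearMap = g.toIntLinearMap := by
    apply LinearMap.pi_ext'
    intro i
    ext
    simpa using h i
  exact congrArg (fun L : (Fin n → ℤ) →ₗ[ℤ] A => L.toAddMonoidHom) this

theorem singleHom_single_left (n m : ℕ) {A : Type} [AddCommGroup A] (x : A) (i : Fin n) :
    singleHom n m x (Pi.single (Fin.castAdd m (Fin.castAdd 1 i)) 1) = 0 := by
  change (Pi.single (Fin.castAdd m (Fin.castAdd 1 i)) (1 : ℤ) : Fin (n + 1 + m) → ℤ) _ • x = 0
  rw [Pi.single_eq_of_ne, zero_smul]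
  simp only [ne_eq, Fin.ext_iff, Fin.val_castAdd, Fin.val_natAdd]
  omega

theorem singleHom_single_right (n m : ℕ) {A : Type} [AddCommGroup A] (x : A) (i : Fin m) :
    singleHom n m x (Pi.single (Fin.natAdd (n + 1) i) 1) = 0 := by
  change (Pi.single (Fin.natAdd (n + 1) i) (1 : ℤ) : Fin (n + 1 + m) → ℤ) _ • x = 0
  rw [Pi.single_eq_of_ne, zero_smul]
  simp only [ne_eq, Fin.ext_iff, Fin.val_castAdd, Fin.val_natAdd]
  omega

theorem singleHom_midIncl (n m : ℕ) {A : Type} [AddCommGroup A] (x : A) (i : Fin 1) :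
    singleHom n m x (midIncl n m 1 (Pi.single i 1)) = x := by
  rw [midIncl_single, Subsingleton.elim i 0]
  change (Pi.single (Fin.castAdd m (Fin.natAdd n 0)) (1 : ℤ) : Fin (n + 1 + m) → ℤ) _ • x = x
  rw [Pi.single_eq_same, one_smul]

theorem twist_single_left (p l n m : ℕ) {s t : ℕ} (f : HopfGen s t) (i : Fin n) :
    twist p l (.mk n f m) (Pi.single (Fin.castAdd m (Fin.castAdd s i)) 1) = 0 := by
  cases f <;> first | rfl | exact singleHom_single_left n m _ i

theorem twist_single_right (p l n m : ℕ) {s t : ℕ} (f : HopfGen s t) (i : Fin m) :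
    twist p l (.mk n f m) (Pi.single (Fin.natAdd (n + s) i) 1) = 0 := by
  cases f <;> first | rfl | exact singleHom_single_right n m _ i

theorem frobLift_midIncl_single (d n m t : ℕ) (i : Fin t) :
    frobLift d (n + t + m) (midIncl n m t (Pi.single i 1)) =
      symPowOf d (midIncl n m t (Pi.single i 1)) := by
  rw [midIncl_single, frobLift_single]

theorem p_smul_twist_midIncl {p : ℕ} (hp : p.Prime) {l : ℕ} (hl : 1 ≤ l) (n : ℕ) {s t : ℕ}
    (f : HopfGen s t) (m : ℕ) (i : Fin s) :
    (p : ℤ) • twist p l (.mk n f m) (midIncl n m s (Pi.single i 1)) =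
      symPowOf (p ^ l) (midIncl n m t (f.hom (Pi.single i 1))) -
        frobLift (p ^ l) (n + t + m) (midIncl n m t (f.hom (Pi.single i 1))) := by
  cases f with
  | tau =>
    have h : HopfGen.tau.hom (Pi.single i 1) = Pi.single (Equiv.swap 0 1 i) 1 := by
      funext j; fin_cases i <;> fin_cases j <;> rfl
    rw [h, frobLift_midIncl_single, sub_self]
    exact smul_zero _
  | mul =>
    have h : HopfGen.mul.hom (Pi.single i 1) = Pi.single 0 1 := by
      funext j; fin_cases i <;> fin_cases j <;> rfl
    rw [h, frobLift_midIncl_single, sub_self]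
    exact smul_zero _
  | comul =>
    have h : HopfGen.comul.hom (Pi.single i 1) = Pi.single 0 1 + Pi.single 1 1 := by
      funext j; fin_cases i; fin_cases j <;> rfl
    rw [h, map_add, map_add, frobLift_midIncl_single, frobLift_midIncl_single, ← sub_sub,
      ← p_smul_comulTwist hp, midIncl_single n m 2, midIncl_single n m 2]
    exact congrArg _ (singleHom_midIncl n m _ i)
  | counit =>
    rw [Subsingleton.elim (HopfGen.counit.hom (Pi.single i 1)) 0, map_zero, map_zero,
      symPowOf_zero (pow_pos hp.pos l).ne', sub_zero]
    exact smul_zero _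
  | unit => exact i.elim0
  | antipode =>
    have h : HopfGen.antipode.hom (Pi.single i 1) = -Pi.single i 1 := by
      funext j; fin_cases i; fin_cases j; rfl
    rw [h, map_neg, map_neg, frobLift_midIncl_single, sub_neg_eq_add, ← p_smul_antipodeTwist hp hl,
      midIncl_single, Subsingleton.elim i 0, ← midIncl_single]
    exact congrArg _ ((singleHom_midIncl n m _ 0).trans (by rw [midIncl_single]))

/-- On the generating edges, `D` is the prescribed twist. -/
theorem frobDefect_edge {p : ℕ} (hp : p.Prime) {l : ℕ} (hl : 1 ≤ l) {a b : GammaVertex}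
    (e : GammaEdge a b) : frobDefect hp l e.hom = twist p l e := by
  obtain ⟨n, f, m⟩ := e
  rename_i s t
  refine addHom_pi_ext fun i => zsmul_symPow_injective hp ?_
  rw [p_smul_frobDefect, frobLift_single, symPowMap_symPowOf]
  simp only [GammaEdge.hom]
  induction i using Fin.addCases with
  | right i => rw [homSum_id_single_right, frobLift_single, sub_self, twist_single_right, smul_zero]
  | left i =>
    induction i using Fin.addCases with
    | left i => rw [homSum_id_single_left, frobLift_single, sub_self, twist_single_left, smul_zero]
    | right i =>
      rw [← midIncl_single, homSum_id_midIncl]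
      exact (p_smul_twist_midIncl hp hl n f m i).symm

/-- `E_d` restricts to `E'_d` along `π`. -/
theorem gammaToAb_comp_frobExtension {p : ℕ} (hp : p.Prime) {l : ℕ} (hl : 1 ≤ l) :
    gammaToAb ⋙ frobExtension hp l = twistedFunctor p l := by
  refine Paths.lift_unique _ _ ?_
  refine Prefunctor.ext (fun _ => rfl) fun a b (e : GammaEdge a b) => ?_
  change (frobExtension hp l).map (gammaToAb.map (Quiver.Hom.toPath e)) = _
  have h : gammaToAb.map (Quiver.Hom.toPath e) = e.hom := Paths.lift_toPath _ _
  rw [h]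
  change AddCommGrpCat.ofHom (twistedHom (p ^ l) e.hom (frobDefect hp l e.hom)) = _
  rw [frobDefect_edge hp hl]
  rfl

/-! ### The generators generate -/

/-- A homomorphism `ℤᵃ → ℤᵇ` is generated if it is a composite of the morphisms
`idₙ ⊕ f ⊕ idₘ` with `f` a generator. -/
def IsGenerated {a b : ℕ} (f : (Fin a → ℤ) →+ (Fin b → ℤ)) : Prop :=
  ∃ P : (show CGamma from (⟨a⟩ : GammaVertex)) ⟶ (show CGamma from (⟨b⟩ : GammaVertex)),
    gammaToAb.map P = f

namespace IsGenerated

theorem id (a : ℕ) : IsGenerated (AddMonoidHom.id (Fin a → ℤ)) := ⟨𝟙 _, gammaToAb.map_id _⟩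

theorem comp {a b c : ℕ} {g : (Fin b → ℤ) →+ (Fin c → ℤ)} {f : (Fin a → ℤ) →+ (Fin b → ℤ)}
    (hg : IsGenerated g) (hf : IsGenerated f) : IsGenerated (g.comp f) := by
  obtain ⟨P, rfl⟩ := hf
  obtain ⟨Q, rfl⟩ := hg
  exact ⟨P ≫ Q, gammaToAb.map_comp _ _⟩

theorem edge (n : ℕ) {s t : ℕ} (f : HopfGen s t) (m : ℕ) :
    IsGenerated (a := n + s + m) (b := n + t + m) (GammaEdge.mk n f m).hom :=
  ⟨Quiver.Hom.toPath (V := GammaVertex) (GammaEdge.mk n f m), Paths.lift_toPath _ _⟩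

/-- An edge with source and target identified with given ranks. -/
theorem of_cast {a b s t n m : ℕ} (f : HopfGen s t) (ha : n + s + m = a) (hb : n + t + m = b)
    (F : (Fin a → ℤ) →+ (Fin b → ℤ))
    (h : ∀ v k, F v (Fin.cast hb k) =
      (Fin.append (Fin.append (fun i => v (Fin.cast ha (Fin.castAdd m (Fin.castAdd s i))))
        (f.hom fun i => v (Fin.cast ha (Fin.castAdd m (Fin.natAdd n i)))))
        (fun i => v (Fin.cast ha (Fin.natAdd (n + s) i))) : Fin (n + t + m) → ℤ) k) :
    IsGenerated F := by
  subst ha hb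
  convert edge n f m
  exact AddMonoidHom.ext fun v => funext (h v)

theorem of_apply_eq {a b : ℕ} {f g : (Fin a → ℤ) →+ (Fin b → ℤ)} (hf : IsGenerated f)
    (h : ∀ v k, g v k = f v k) : IsGenerated g := by
  rwa [show g = f from AddMonoidHom.ext fun v => funext (h v)]

end IsGenerated

/-- The homomorphism `v ↦ v ∘ σ` permuting coordinates. -/
def permHom {a b : ℕ} (σ : Fin b ≃ Fin a) : (Fin a → ℤ) →+ (Fin b → ℤ) :=
  AddMonoidHom.mk' (fun v => v ∘ σ) fun _ _ => rfl

section EdgeValues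

variable {n s t m : ℕ} (f : HopfGen s t) (v : Fin (n + s + m) → ℤ) (k : Fin (n + t + m))

theorem edge_hom_apply_left (k' : Fin (n + s + m)) (hk : (k : ℕ) < n) (h : (k' : ℕ) = k) :
    (GammaEdge.mk n f m).hom v k = v k' := by
  obtain ⟨i, rfl⟩ : ∃ i : Fin n, k = Fin.castAdd m (Fin.castAdd t i) := ⟨⟨k, hk⟩, rfl⟩
  obtain rfl : k' = Fin.castAdd m (Fin.castAdd s i) := Fin.ext h
  exact (congrFun (homSum_id_apply n m f.hom v) _).trans (by rw [Fin.append_left, Fin.append_left])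

theorem edge_hom_apply_mid (i : Fin t) (h : (k : ℕ) = n + i) :
    (GammaEdge.mk n f m).hom v k = f.hom (fun i => v (Fin.castAdd m (Fin.natAdd n i))) i := by
  obtain rfl : k = Fin.castAdd m (Fin.natAdd n i) := Fin.ext h
  exact (congrFun (homSum_id_apply n m f.hom v) _).trans (by rw [Fin.append_left, Fin.append_right])

theorem edge_hom_apply_right (k' : Fin (n + s + m)) (hk : n + t ≤ k) (h : (k' : ℕ) + t = k + s) :
    (GammaEdge.mk n f m).hom v k = v k' := by
  obtain ⟨i, rfl⟩ : ∃ i : Fin m, k = Fin.natAdd (n + t) i :=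
    ⟨⟨k - (n + t), by omega⟩, Fin.ext (by simp; omega)⟩
  obtain rfl : k' = Fin.natAdd (n + s) i := Fin.ext (by simp at h ⊢; omega)
  exact (congrFun (homSum_id_apply n m f.hom v) _).trans (by rw [Fin.append_right])

end EdgeValues

theorem isGenerated_permHom_swap (n : ℕ) (i : Fin n) :
    IsGenerated (permHom (Equiv.swap i.castSucc i.succ)) := by
  obtain ⟨i, hi⟩ := i
  obtain ⟨m, rfl⟩ : ∃ m, n = i + 1 + m := ⟨n - (i + 1), by omega⟩
  refine IsGenerated.of_cast (n := i) (m := m) .tau (by omega) (by omega) _ fun v k => ?_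
  change v (Equiv.swap _ _ _) = _
  rw [Equiv.swap_apply_def]
  simp only [Fin.ext_iff, Fin.val_cast, Fin.val_succ, Fin.val_castSucc]
  induction k using Fin.addCases with
  | right k =>
    rw [Fin.append_right, Fin.val_natAdd, if_neg (by omega), if_neg (by omega)]
  | left k =>
    rw [Fin.append_left, Fin.val_castAdd]
    induction k using Fin.addCases with
    | left k =>
      rw [Fin.append_left, Fin.val_castAdd, if_neg (by omega), if_neg (by omega)]
    | right k =>
      rw [Fin.append_right, Fin.val_natAdd]
      match k with
      | 0 => rw [if_pos (by simp)]; rfl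
      | 1 => rw [if_neg (by simp), if_pos (by simp)]; rfl

theorem isGenerated_permHom_perm {a : ℕ} (σ : Equiv.Perm (Fin a)) : IsGenerated (permHom σ) := by
  cases a with
  | zero => rw [Subsingleton.elim σ 1]; exact .id 0
  | succ n =>
    have h : σ ∈ Submonoid.closure (Set.range fun i : Fin n => Equiv.swap i.castSucc i.succ) := by
      rw [Equiv.Perm.mclosure_swap_castSucc_succ]; trivial
    induction h using Submonoid.closure_induction with
    | mem σ h => obtain ⟨i, rfl⟩ := h; exact isGenerated_permHom_swap n i
    | one => exact .id _
    | mul σ τ _ _ hσ hτ => exact hτ.comp hσ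

theorem isGenerated_permHom {a b : ℕ} (σ : Fin b ≃ Fin a) : IsGenerated (permHom σ) := by
  obtain rfl := Fin.equiv_iff_eq.1 ⟨σ⟩
  exact isGenerated_permHom_perm σ

/-- The transvection `v ↦ v + c vᵢ eⱼ`. -/
def transvectionHom {a : ℕ} (i j : Fin a) (c : ℤ) : (Fin a → ℤ) →+ (Fin a → ℤ) :=
  AddMonoidHom.mk' (fun v => v + Pi.single j (c * v i)) fun v w => by
    rw [Pi.add_apply, mul_add, Pi.single_add]; abel

theorem transvectionHom_apply {a : ℕ} (i j : Fin a) (c : ℤ) (v : Fin a → ℤ) :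
    transvectionHom i j c v = v + Pi.single j (c * v i) := rfl

/-- `Δ` on the last coordinate followed by `∇` on the two before it adds the last coordinate to
the last but one. -/
theorem isGenerated_transvectionHom_last (k : ℕ) :
    IsGenerated (transvectionHom (Fin.last (k + 1)) (Fin.last k).castSucc 1) := by
  refine IsGenerated.of_apply_eq
    ((IsGenerated.edge k .mul 1).comp (IsGenerated.edge (k + 1) .comul 0)) fun v j => ?_
  rw [transvectionHom_apply, Pi.add_apply, one_mul]
  change _ = (GammaEdge.mk k .mul 1).hom ((GammaEdge.mk (k + 1) .comul 0).hom v) j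
  obtain hj | hj | hj : (j : ℕ) < k ∨ (j : ℕ) = k ∨ (j : ℕ) = k + 1 := by omega
  · rw [edge_hom_apply_left .mul _ j ⟨j, by omega⟩ hj rfl,
      edge_hom_apply_left (n := k + 1) (m := 0) .comul v ⟨j, by omega⟩ j (by simp; omega) rfl,
      Pi.single_eq_of_ne, add_zero]
    simp only [ne_eq, Fin.ext_iff, Fin.val_castSucc, Fin.val_last]; omega
  · rw [edge_hom_apply_mid .mul _ j 0 (by simpa using hj)]
    change _ = (GammaEdge.mk (k + 1) .comul 0).hom v (⟨k, by omega⟩ : Fin (k + 3)) +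
      (GammaEdge.mk (k + 1) .comul 0).hom v (⟨k + 1, by omega⟩ : Fin (k + 3))
    rw [edge_hom_apply_left (n := k + 1) (m := 0) .comul v ⟨k, by omega⟩ j (by simp) hj,
      edge_hom_apply_mid (n := k + 1) (m := 0) .comul v ⟨k + 1, by omega⟩ 0 rfl]
    obtain rfl : j = (Fin.last k).castSucc := Fin.ext hj
    rw [Pi.single_eq_same]
    rfl
  · rw [edge_hom_apply_right .mul _ j ⟨k + 2, by omega⟩ (by omega) (by simp; omega),
      edge_hom_apply_mid (n := k + 1) (m := 0) .comul v ⟨k + 2, by omega⟩ 1 rfl]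
    obtain rfl : j = Fin.last (k + 1) := Fin.ext hj
    rw [Pi.single_eq_of_ne, add_zero]
    · rfl
    · simp only [ne_eq, Fin.ext_iff, Fin.val_castSucc, Fin.val_last]; omega

/-- Conjugation by the antipode on the last coordinate inverts the transvection. -/
theorem isGenerated_transvectionHom_last_neg (k : ℕ) :
    IsGenerated (transvectionHom (Fin.last (k + 1)) (Fin.last k).castSucc (-1)) := by
  refine IsGenerated.of_apply_eq (((IsGenerated.edge (k + 1) .antipode 0).comp
    (isGenerated_transvectionHom_last k)).comp (IsGenerated.edge (k + 1) .antipode 0))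
    fun v j => ?_
  change _ = (GammaEdge.mk (k + 1) .antipode 0).hom
    (transvectionHom (Fin.last (k + 1)) (Fin.last k).castSucc 1
      ((GammaEdge.mk (k + 1) .antipode 0).hom v)) j
  have hlast (w : Fin (k + 2) → ℤ) :
      (GammaEdge.mk (k + 1) .antipode 0).hom w (Fin.last (k + 1)) = - w (Fin.last (k + 1)) :=
    edge_hom_apply_mid (n := k + 1) (m := 0) .antipode w (Fin.last (k + 1)) 0 rfl
  have hinit (w : Fin (k + 2) → ℤ) (j : Fin (k + 2)) (hj : (j : ℕ) < k + 1) :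
      (GammaEdge.mk (k + 1) .antipode 0).hom w j = w j :=
    edge_hom_apply_left (n := k + 1) (m := 0) .antipode w j j hj rfl
  obtain hj | hj : (j : ℕ) < k + 1 ∨ (j : ℕ) = k + 1 := by omega
  · rw [hinit _ j hj, transvectionHom_apply, transvectionHom_apply, Pi.add_apply, Pi.add_apply,
      hinit v j hj, hlast, neg_one_mul, one_mul]
  · obtain rfl : j = Fin.last (k + 1) := Fin.ext hj
    have hne : Fin.last (k + 1) ≠ (Fin.last k).castSucc := by
      simp only [ne_eq, Fin.ext_iff, Fin.val_castSucc, Fin.val_last]; omega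
    rw [hlast, transvectionHom_apply, transvectionHom_apply, Pi.add_apply, Pi.add_apply,
      Pi.single_eq_of_ne hne, Pi.single_eq_of_ne hne, hlast]
    ring

theorem permHom_comp_transvectionHom {a : ℕ} (σ : Equiv.Perm (Fin a)) (i j : Fin a) (c : ℤ) :
    ((permHom σ.symm).comp (transvectionHom i j c)).comp (permHom σ) =
      transvectionHom (σ i) (σ j) c := by
  refine AddMonoidHom.ext fun v => funext fun k => ?_
  change (v ∘ σ + Pi.single j (c * v (σ i)) : Fin a → ℤ) (σ.symm k) =
    v k + (Pi.single (σ j) (c * v (σ i)) : Fin a → ℤ) k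
  rw [Pi.add_apply, Function.comp_apply, Equiv.apply_symm_apply]
  congr 1
  simp only [Pi.single_apply, Equiv.symm_apply_eq]

/-- A permutation of the coordinates conjugates any transvection to one that adds a multiple of the
last coordinate to the last but one. -/
theorem isGenerated_transvectionHom {a : ℕ} {i j : Fin a} (hij : i ≠ j) (c : ℤ) :
    IsGenerated (transvectionHom i j c) := by
  obtain ⟨k, rfl⟩ : ∃ k, a = k + 2 := ⟨a - 2, by have := i.2; have := j.2; omega⟩
  obtain ⟨σ, hi, hj⟩ : ∃ σ : Equiv.Perm (Fin (k + 2)),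
      σ (Fin.last (k + 1)) = i ∧ σ (Fin.last k).castSucc = j := by
    have hne : Fin.last (k + 1) ≠ (Fin.last k).castSucc := by
      simp only [ne_eq, Fin.ext_iff, Fin.val_castSucc, Fin.val_last]; omega
    let τ := Equiv.swap (Fin.last (k + 1)) i
    refine ⟨τ.trans (Equiv.swap (τ (Fin.last k).castSucc) j), ?_, by simp⟩
    have hi : τ (Fin.last (k + 1)) = i := Equiv.swap_apply_left _ _
    rw [Equiv.trans_apply, hi, Equiv.swap_apply_of_ne_of_ne _ hij]
    rw [← hi]
    exact τ.injective.ne hne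
  have key : ∀ c, IsGenerated (transvectionHom (Fin.last (k + 1)) (Fin.last k).castSucc c) →
      IsGenerated (transvectionHom i j c) := by
    intro c hc
    rw [← hi, ← hj, ← permHom_comp_transvectionHom]
    exact ((isGenerated_permHom _).comp hc).comp (isGenerated_permHom _)
  have hadd : ∀ c c', (transvectionHom i j c).comp (transvectionHom i j c') =
      transvectionHom i j (c + c') := by
    intro c c'
    refine AddMonoidHom.ext fun v => ?_
    simp only [AddMonoidHom.comp_apply, transvectionHom_apply, Pi.add_apply,
      Pi.single_eq_of_ne hij, add_zero, add_mul, Pi.single_add]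
    abel
  induction c with
  | zero =>
    refine (IsGenerated.id (k + 2)).of_apply_eq fun v j => ?_
    simp [transvectionHom_apply]
  | succ n ih => rw [← hadd]; exact ih.comp (key _ (isGenerated_transvectionHom_last k))
  | pred n ih =>
    rw [sub_eq_add_neg, ← hadd]; exact ih.comp (key _ (isGenerated_transvectionHom_last_neg k))

/-- The homomorphism `ℤᵐ ⊕ ℤⁿ → ℤᵐ ⊕ ℤⁿ`, `(v, w) ↦ (v, w + g v)`. -/
def shearHom {m n : ℕ} (g : (Fin m → ℤ) →+ (Fin n → ℤ)) :
    (Fin (m + n) → ℤ) →+ (Fin (m + n) → ℤ) :=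
  AddMonoidHom.mk' (fun v => Fin.append (fun i => v (Fin.castAdd n i))
    ((fun i => v (Fin.natAdd m i)) + g fun i => v (Fin.castAdd n i))) fun v w => by
    have hg := g.map_add (fun i => v (Fin.castAdd n i)) (fun i => w (Fin.castAdd n i))
    funext i
    induction i using Fin.addCases with
    | left i => simp
    | right i =>
      have := congrFun hg i
      simp only [Pi.add_def] at this
      simp [Pi.add_def, this]
      ring

theorem shearHom_apply {m n : ℕ} (g : (Fin m → ℤ) →+ (Fin n → ℤ)) (v : Fin (m + n) → ℤ) :
    shearHom g v = Fin.append (fun i => v (Fin.castAdd n i))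
      ((fun i => v (Fin.natAdd m i)) + g fun i => v (Fin.castAdd n i)) := rfl

theorem isGenerated_shearHom {m n : ℕ} (g : (Fin m → ℤ) →+ (Fin n → ℤ)) :
    IsGenerated (shearHom g) := by
  let S : AddSubmonoid ((Fin m → ℤ) →+ (Fin n → ℤ)) :=
    { carrier := {g | IsGenerated (shearHom g)}
      zero_mem' := by
        change IsGenerated _
        refine (IsGenerated.id (m + n)).of_apply_eq fun v k => ?_
        rw [shearHom_apply]
        induction k using Fin.addCases <;> simp
      add_mem' := by
        intro g g' hg hg'
        change IsGenerated _
        refine (hg.comp hg').of_apply_eq fun v k => ?_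
        simp only [AddMonoidHom.comp_apply, shearHom_apply]
        induction k using Fin.addCases <;> simp; ring }
  -- `E i j` is the part of `g` given by its `(j, i)` matrix entry; its shear is a transvection
  let E (i : Fin m) (j : Fin n) : (Fin m → ℤ) →+ (Fin n → ℤ) :=
    AddMonoidHom.mk' (fun v => Pi.single j (g (Pi.single i 1) j * v i)) fun v w => by
      rw [Pi.add_apply, mul_add, Pi.single_add]
  have hE : ∀ i j, E i j ∈ S := by
    intro i j
    change IsGenerated _
    refine (isGenerated_transvectionHom (i := Fin.castAdd n i) (j := Fin.natAdd m j)
      (by simp only [ne_eq, Fin.ext_iff, Fin.val_castAdd, Fin.val_natAdd]; omega)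
      (g (Pi.single i 1) j)).of_apply_eq fun v k => ?_
    rw [shearHom_apply, transvectionHom_apply]
    induction k using Fin.addCases with
    | left k =>
      rw [Fin.append_left, Pi.add_apply, Pi.single_eq_of_ne, add_zero]
      simp only [ne_eq, Fin.ext_iff, Fin.val_castAdd, Fin.val_natAdd]; omega
    | right k =>
      rw [Fin.append_right, Pi.add_apply, Pi.add_apply]
      congr 1
      change (Pi.single j _ : Fin n → ℤ) k = _
      simp [Pi.single_apply, Fin.ext_iff]
  have hg : g = ∑ i, ∑ j, E i j := by
    refine addHom_pi_ext fun i => ?_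
    funext j
    simp only [AddMonoidHom.finsetSum_apply, Finset.sum_apply, E, AddMonoidHom.mk'_apply]
    rw [Finset.sum_eq_single i, Finset.sum_eq_single j] <;> simp +contextual [Pi.single_apply]
  rw [hg]
  exact S.sum_mem fun i _ => S.sum_mem fun j _ => hE i j

/-- The inclusion `ℤᵐ → ℤᵐ⁺ⁿ` of the first summand. -/
def firstIncl (m n : ℕ) : (Fin m → ℤ) →+ (Fin (m + n) → ℤ) :=
  AddMonoidHom.mk' (fun v => Fin.append v 0) fun v w => by
    funext i; induction i using Fin.addCases <;> simp

/-- The projection `ℤᵐ⁺ⁿ → ℤᵐ` to the first summand. -/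
def firstProj (m n : ℕ) : (Fin (m + n) → ℤ) →+ (Fin m → ℤ) :=
  AddMonoidHom.mk' (fun v i => v (Fin.castAdd n i)) fun _ _ => rfl

theorem isGenerated_firstIncl (m n : ℕ) : IsGenerated (firstIncl m n) := by
  induction n with
  | zero =>
    refine (IsGenerated.id m).of_apply_eq fun v k => ?_
    exact Fin.append_left v 0 k
  | succ n ih =>
    refine IsGenerated.of_apply_eq (b := m + n + 1) ((IsGenerated.edge (m + n) .unit 0).comp ih)
      fun v k => ?_
    change (Fin.append v 0 : Fin (m + (n + 1)) → ℤ) k =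
      (GammaEdge.mk (m + n) .unit 0).hom (Fin.append v 0 : Fin (m + n) → ℤ) k
    obtain hk | hk : (k : ℕ) < m + n ∨ (k : ℕ) = m + n := by omega
    · rw [edge_hom_apply_left (n := m + n) (m := 0) .unit _ k ⟨k, hk⟩ hk rfl]
      obtain hk' | hk' := lt_or_ge (k : ℕ) m
      · exact (Fin.append_left v 0 ⟨k, hk'⟩).trans (Fin.append_left v 0 ⟨k, hk'⟩).symm
      · obtain ⟨i, rfl⟩ : ∃ i : Fin n, k = Fin.natAdd m i.castSucc :=
          ⟨⟨k - m, by omega⟩, Fin.ext (by simp; omega)⟩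
        rw [Fin.append_right]
        exact (Fin.append_right v 0 i).symm
    · rw [edge_hom_apply_mid (n := m + n) (m := 0) .unit _ k 0 hk]
      obtain rfl : k = Fin.natAdd m (Fin.last n) := Fin.ext hk
      exact Fin.append_right v 0 _

theorem isGenerated_firstProj (m n : ℕ) : IsGenerated (firstProj m n) := by
  induction n with
  | zero => exact IsGenerated.id m
  | succ n ih =>
    refine IsGenerated.of_apply_eq (a := m + n + 1)
      (ih.comp (IsGenerated.edge (m + n) .counit 0)) fun v k => ?_
    exact (edge_hom_apply_left (n := m + n) (m := 0) .counit v (Fin.castAdd n k)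
      (Fin.castAdd (n + 1) k) (by simp; omega) rfl).symm

/-- Every homomorphism `ℤᵐ → ℤⁿ` is a composite of generators: factor `f` as
`v ↦ (v, 0) ↦ (v, f v) ↦ (f v, v) ↦ f v`. -/
theorem isGenerated {m n : ℕ} (f : (Fin m → ℤ) →+ (Fin n → ℤ)) : IsGenerated f := by
  refine ((((isGenerated_firstProj n m).comp (isGenerated_permHom finAddFlip)).comp
    (isGenerated_shearHom f)).comp (isGenerated_firstIncl m n)).of_apply_eq fun v k => ?_
  change f v k = shearHom f (Fin.append v 0) (finAddFlip (Fin.castAdd m k))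
  rw [finAddFlip_apply_castAdd, shearHom_apply, Fin.append_right]
  simp

/-- A functor out of `ab` is determined by its restriction to `C_Γ`. -/
theorem eq_of_gammaToAb_comp_eq {F G : FunAb} (h : gammaToAb ⋙ F = gammaToAb ⋙ G) : F = G := by
  refine CategoryTheory.Functor.ext (fun n => Functor.congr_obj h (⟨n.rank⟩ : GammaVertex))
    fun m n f => ?_
  obtain ⟨P, hP⟩ := isGenerated (m := m.rank) (n := n.rank) f
  obtain rfl : gammaToAb.map P = f := hP
  exact Functor.congr_hom h P

/-! ### Functors on `ab`, scalars and `Ext` -/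

section ExtScalars

variable {C : Type*} [Category* C] [Abelian C] [HasExt C] {X Y Z : C} {n : ℕ}

theorem ext_mk₀_zsmul (k : ℤ) (f : X ⟶ Y) : Ext.mk₀ (k • f) = k • Ext.mk₀ f :=
  map_zsmul Ext.addEquiv₀.symm k f

theorem ext_comp_mk₀_zsmul (x : Ext X Y n) (k : ℤ) (f : Y ⟶ Z) :
    x.comp (Ext.mk₀ (k • f)) (add_zero n) = k • x.comp (Ext.mk₀ f) (add_zero n) := by
  rw [ext_mk₀_zsmul]
  exact map_zsmul (x.precomp Z (add_zero n)) k (Ext.mk₀ f)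

theorem ext_mk₀_zsmul_comp (k : ℤ) (f : X ⟶ Y) (x : Ext Y Z n) :
    (Ext.mk₀ (k • f)).comp x (zero_add n) = k • (Ext.mk₀ f).comp x (zero_add n) := by
  rw [ext_mk₀_zsmul]
  exact map_zsmul (x.postcomp X (zero_add n)) k (Ext.mk₀ f)

end ExtScalars

/-- The generator of `I(1) = ℤ`. -/
def oneVec : inclFunctor.obj ⟨1⟩ := (fun _ => 1 : Fin 1 → ℤ)

/-- The morphism `1 ⟶ n` of `ab` with `e₁ ↦ v`. -/
def vecHom (n : FreeAb) (v : Fin n.rank → ℤ) : (⟨1⟩ : FreeAb) ⟶ n :=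
  (AddMonoidHom.mk' (fun w => w 0 • v) fun w w' => add_smul (w 0) (w' 0) v :
    (Fin 1 → ℤ) →+ (Fin n.rank → ℤ))

theorem inclFunctor_map_vecHom (n : FreeAb) (v : Fin n.rank → ℤ) :
    inclFunctor.map (vecHom n v) oneVec = v :=
  one_smul ℤ v

theorem natTrans_app_apply {F G : FunAb} (φ : F ⟶ G) {m n : FreeAb} (f : m ⟶ n) (x : F.obj m) :
    φ.app n (F.map f x) = G.map f (φ.app m x) :=
  congrArg (fun g => g x) (φ.naturality f)

/-- A morphism out of `I` is determined by its value on the generator of `I(1)`. -/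
theorem inclFunctor_app_apply {F : FunAb} (φ : inclFunctor ⟶ F) (n : FreeAb)
    (v : Fin n.rank → ℤ) : φ.app n v = F.map (vecHom n v) (φ.app ⟨1⟩ oneVec) := by
  rw [← natTrans_app_apply, inclFunctor_map_vecHom]

theorem inclFunctor_hom_ext {F : FunAb} {φ ψ : inclFunctor ⟶ F}
    (h : φ.app ⟨1⟩ oneVec = ψ.app ⟨1⟩ oneVec) : φ = ψ := by
  ext n v
  exact (inclFunctor_app_apply φ n v).trans (h ▸ (inclFunctor_app_apply ψ n v).symm)

/-- A morphism `I → F` takes the generator of `I(1)` to a primitive element of `F(1)`: the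
images under `e₁ ↦ e₁`, `e₁ ↦ e₂` and `e₁ ↦ e₁ + e₂` in `F(2)` add up. -/
theorem inclFunctor_hom_additive {F : FunAb} (φ : inclFunctor ⟶ F) :
    F.map (vecHom ⟨2⟩ ![1, 1]) (φ.app ⟨1⟩ oneVec) =
      F.map (vecHom ⟨2⟩ ![1, 0]) (φ.app ⟨1⟩ oneVec) +
        F.map (vecHom ⟨2⟩ ![0, 1]) (φ.app ⟨1⟩ oneVec) := by
  rw [← inclFunctor_app_apply, ← inclFunctor_app_apply, ← inclFunctor_app_apply]
  have h : (![1, 1] : Fin 2 → ℤ) = ![1, 0] + ![0, 1] := by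
    funext i; fin_cases i <;> rfl
  rw [h]
  exact map_add (φ.app ⟨2⟩).hom (![1, 0] : Fin 2 → ℤ) (![0, 1] : Fin 2 → ℤ)

theorem funAb_epi_app_surjective {F G : FunAb} (φ : F ⟶ G) [Epi φ] (n : FreeAb) :
    Function.Surjective (φ.app n) :=
  (AddCommGrpCat.epi_iff_surjective (φ.app n)).1 inferInstance

/-- The functor `n ↦ ℤ[Hom(1, n)]`. -/
noncomputable def freeRep : FunAb :=
  coyoneda.obj (Opposite.op ⟨1⟩) ⋙ AddCommGrpCat.free

/-- The morphism `ℤ[Hom(1, -)] → F` that corresponds to an element of `F(1)`. -/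
noncomputable def freeRepDesc (F : FunAb) (x : F.obj ⟨1⟩) : freeRep ⟶ F where
  app n := AddCommGrpCat.ofHom (FreeAbelianGroup.lift fun g : (⟨1⟩ : FreeAb) ⟶ n => F.map g x)
  naturality m n f := by
    ext1
    refine FreeAbelianGroup.lift_ext _ _ fun g => ?_
    change FreeAbelianGroup.lift _ (FreeAbelianGroup.map _ (FreeAbelianGroup.of g)) =
      F.map f (FreeAbelianGroup.lift _ (FreeAbelianGroup.of g))
    rw [FreeAbelianGroup.map_of_apply, FreeAbelianGroup.lift_apply_of,
      FreeAbelianGroup.lift_apply_of]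
    exact congrArg (fun k => k x) (F.map_comp g f)

/-- The universal element of `ℤ[Hom(1, 1)]`. -/
noncomputable def freeRepOne : freeRep.obj ⟨1⟩ := FreeAbelianGroup.of (𝟙 (⟨1⟩ : FreeAb))

theorem freeRepDesc_app_of (F : FunAb) (x : F.obj ⟨1⟩) (n : FreeAb) (g : (⟨1⟩ : FreeAb) ⟶ n) :
    (freeRepDesc F x).app n (FreeAbelianGroup.of g : FreeAbelianGroup ((⟨1⟩ : FreeAb) ⟶ n)) =
      F.map g x :=
  FreeAbelianGroup.lift_apply_of _ _

theorem freeRep_hom_ext {F : FunAb} {φ ψ : freeRep ⟶ F}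
    (h : φ.app ⟨1⟩ freeRepOne = ψ.app ⟨1⟩ freeRepOne) : φ = ψ := by
  ext1
  ext1 n
  ext1
  refine FreeAbelianGroup.lift_ext _ _ fun g => ?_
  have hg : freeRep.map g freeRepOne =
      (FreeAbelianGroup.of g : FreeAbelianGroup ((⟨1⟩ : FreeAb) ⟶ n)) := by
    change FreeAbelianGroup.map _ (FreeAbelianGroup.of _) = _
    rw [FreeAbelianGroup.map_of_apply]
    exact congrArg _ (Category.id_comp g)
  change φ.app n (FreeAbelianGroup.of g : FreeAbelianGroup ((⟨1⟩ : FreeAb) ⟶ n)) =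
    ψ.app n (FreeAbelianGroup.of g : FreeAbelianGroup ((⟨1⟩ : FreeAb) ⟶ n))
  rw [← hg, natTrans_app_apply, natTrans_app_apply, h]

/-- By the Yoneda lemma, `ℤ[Hom(1, -)]` is projective. -/
instance : Projective freeRep where
  factors {E X} f e _ := by
    obtain ⟨y, hy⟩ := funAb_epi_app_surjective e ⟨1⟩ (f.app ⟨1⟩ freeRepOne)
    refine ⟨freeRepDesc E y, freeRep_hom_ext ?_⟩
    change e.app ⟨1⟩ ((freeRepDesc E y).app ⟨1⟩ freeRepOne) = _
    rw [← hy]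
    refine congrArg _ ((freeRepDesc_app_of E y _ _).trans ?_)
    rw [E.map_id]
    rfl

instance : Epi (freeRepDesc inclFunctor oneVec) := by
  have : ∀ n, Epi ((freeRepDesc inclFunctor oneVec).app n) := by
    intro n
    rw [AddCommGrpCat.epi_iff_surjective]
    intro v
    exact ⟨_, (freeRepDesc_app_of inclFunctor oneVec n (vecHom n v)).trans
      (inclFunctor_map_vecHom n v)⟩
  exact NatTrans.epi_of_epi_app _

/-- The endomorphism of a functor `F` given by the central endomorphisms `k · id` of `ab`. -/
def scalarEnd (k : ℤ) (F : FunAb) : F ⟶ F where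
  app n := F.map (k • AddMonoidHom.id (Fin n.rank → ℤ) : (Fin n.rank → ℤ) →+ (Fin n.rank → ℤ))
  naturality m n f := by
    rw [← F.map_comp, ← F.map_comp]
    congr 1
    refine AddMonoidHom.ext fun v => ?_
    exact (map_zsmul (show (Fin m.rank → ℤ) →+ (Fin n.rank → ℤ) from f) k v).symm

theorem scalarEnd_comm (k : ℤ) {F G : FunAb} (φ : F ⟶ G) :
    scalarEnd k F ≫ φ = φ ≫ scalarEnd k G := by
  ext1; ext1 n
  exact φ.naturality _

theorem scalarEnd_inclFunctor (k : ℤ) : scalarEnd k inclFunctor = k • 𝟙 inclFunctor := by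
  ext1; ext1 n
  rw [NatTrans.app_zsmul]
  rfl

theorem scalarEnd_symFunctor (d : ℕ) (k : ℤ) :
    scalarEnd k (symFunctor d) = (k ^ d) • 𝟙 (symFunctor d) := by
  ext n x
  rw [NatTrans.app_zsmul]
  exact symPowMap_zsmul_id d k x

/-- Multiplication by `k` on `ab` acts on `Ext¹(I, F)` through both arguments in the same way. -/
theorem ext_comp_scalarEnd (k : ℤ) {F : FunAb} (x : Ext inclFunctor F 1) :
    x.comp (Ext.mk₀ (scalarEnd k F)) (add_zero 1) =
      (Ext.mk₀ (scalarEnd k inclFunctor)).comp x (zero_add 1) := by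
  -- `Ext¹(ℤ[Hom(1, -)], F) = 0`, so `x` is the pushout of `0 → ker π → ℤ[Hom(1, -)] → I → 0` along
  -- a morphism `φ : ker π ⟶ F`, and `k` acts on this sequence
  let π := freeRepDesc inclFunctor oneVec
  let T : ShortComplex FunAb := .mk (Limits.kernel.ι π) π (Limits.kernel.condition π)
  have hT : T.ShortExact := { exact := ShortComplex.exact_kernel π }
  have : Projective T.X₂ := inferInstanceAs (Projective freeRep)
  obtain ⟨x₁, hx₁⟩ := Ext.contravariant_sequence_exact₃ hT F x
    (Ext.eq_zero_of_projective _) (add_zero 1)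
  obtain ⟨φ, rfl⟩ := Ext.mk₀_bijective _ _ |>.2 x₁
  let s : T ⟶ T :=
    { τ₁ := scalarEnd k _
      τ₂ := scalarEnd k _
      τ₃ := scalarEnd k _
      comm₁₂ := scalarEnd_comm k _
      comm₂₃ := scalarEnd_comm k _ }
  have hs := hT.extClass_naturality hT s
  rw [← hx₁, Ext.comp_assoc_of_third_deg_zero, Ext.mk₀_comp_mk₀, ← scalarEnd_comm,
    ← Ext.mk₀_comp_mk₀, ← Ext.comp_assoc_of_third_deg_zero]
  rw [hs, Ext.comp_assoc_of_third_deg_zero]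

/-- `2` acts on `I` as `2` and on `Sᵈ` as `2ᵈ`. -/
theorem ext_inclFunctor_symFunctor_torsion (d : ℕ) (x : Ext inclFunctor (symFunctor d) 1) :
    ((2 : ℤ) ^ d - 2) • x = 0 := by
  have h := ext_comp_scalarEnd 2 x
  rw [scalarEnd_symFunctor, scalarEnd_inclFunctor, ext_comp_mk₀_zsmul, ext_mk₀_zsmul_comp,
    Ext.comp_mk₀_id, Ext.mk₀_id_comp] at h
  rw [sub_smul, h, sub_self]

/-! ### Reduction modulo `N` -/

/-- The generator `e₁ᵈ` of `Sᵈ(ℤ)`. -/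
noncomputable def onePow (d : ℕ) : (symFunctor d).obj ⟨1⟩ := symPowOf d (fun _ => 1 : Fin 1 → ℤ)

theorem frobLift_one (d : ℕ) :
    frobLift d 1 (fun _ => 1) = symPowOf d (fun _ => 1 : Fin 1 → ℤ) := by
  have h : (fun _ => 1 : Fin 1 → ℤ) = Pi.single 0 1 := by
    funext i; rw [Subsingleton.elim i 0]; simp
  rw [h, frobLift_single]

theorem exists_zsmul_onePow (d : ℕ) (x : (symFunctor d).obj ⟨1⟩) : ∃ c : ℤ, x = c • onePow d :=
  exists_zsmul_symPowOf d (fun _ => 1 : Fin 1 → ℤ)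
    (fun v => ⟨v 0, funext fun i => by rw [Subsingleton.elim i 0]; simp⟩) x

theorem symFunctor_map_vecHom_onePow (d : ℕ) (v : Fin 2 → ℤ) :
    (symFunctor d).map (vecHom ⟨2⟩ v) (onePow d) = symPowOf d v :=
  (symPowMap_symPowOf d _ _).trans (congrArg (symPowOf d) (inclFunctor_map_vecHom ⟨2⟩ v))

/-- If `c vᵈ`, as a function of `v`, is additive modulo `N` on the standard basis of `ℤ²`, then `N`
divides `c p`. This includes the case `N = 0`. -/
theorem dvd_mul_prime_of_additive {p l : ℕ} (hp : p.Prime) (hl : 1 ≤ l) {N c : ℤ}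
    {z : symPow (p ^ l) (Fin 2 → ℤ)}
    (h : N • z = c • symPowOf (p ^ l) ![1, 1] - c • symPowOf (p ^ l) ![1, 0] -
      c • symPowOf (p ^ l) ![0, 1]) : N ∣ c * p := by
  refine dvd_mul_prime_of_dvd_mul_choose hp hl fun k h0 h1 => ?_
  obtain ⟨g, hg1, hg2, hg3⟩ := exists_binomialFunctional h0 h1
  have h' := congrArg (fun x : symPow (p ^ l) (Fin 2 → ℤ) => g x) h
  simp only [Submodule.coe_smul, Submodule.coe_sub, map_sub, map_zsmul, coe_symPowOf, hg1, hg2,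
    hg3, smul_eq_mul, mul_zero, sub_zero] at h'
  exact ⟨_, h'.symm⟩

section MulSequence

variable (d : ℕ) (N : ℤ)

/-- The functor `Sᵈ/N`. -/
noncomputable def symQuot : FunAb := Limits.cokernel (N • 𝟙 (symFunctor d))

/-- The projection `Sᵈ → Sᵈ/N`. -/
noncomputable def symQuotπ : symFunctor d ⟶ symQuot d N :=
  Limits.cokernel.π (N • 𝟙 (symFunctor d))

instance : Epi (symQuotπ d N) := Limits.coequalizer.π_epi

theorem zsmul_id_comp_symQuotπ : (N • 𝟙 (symFunctor d)) ≫ symQuotπ d N = 0 :=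
  Limits.cokernel.condition _

/-- The complex `Sᵈ → Sᵈ → Sᵈ/N` whose first map is multiplication by `N`. -/
noncomputable abbrev mulComplex : ShortComplex FunAb :=
  .mk (N • 𝟙 (symFunctor d)) (symQuotπ d N) (zsmul_id_comp_symQuotπ d N)

variable {d N}

theorem zsmul_id_app_apply (n : FreeAb) (x : (symFunctor d).obj n) :
    (N • 𝟙 (symFunctor d)).app n x = N • x := by
  rw [NatTrans.app_zsmul]
  rfl

theorem mulComplex_shortExact (hN : N ≠ 0) : (mulComplex d N).ShortExact where
  exact := ShortComplex.exact_cokernel _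
  mono_f := by
    have : ∀ n, Mono ((N • 𝟙 (symFunctor d)).app n) := by
      intro n
      rw [AddCommGrpCat.mono_iff_injective]
      intro x y h
      rw [zsmul_id_app_apply, zsmul_id_app_apply] at h
      have key : ∀ x y : symPow d (Fin n.rank → ℤ), N • x = N • y → x = y :=
        fun x y h => smul_right_injective _ hN h
      exact key x y h
    exact NatTrans.mono_of_mono_app _

theorem exists_zsmul_eq_of_symQuotπ_app_eq_zero (hN : N ≠ 0) (n : FreeAb) (x : (symFunctor d).obj n)
    (hx : (symQuotπ d N).app n x = 0) : ∃ z : (symFunctor d).obj n, N • z = x := by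
  have h := ((mulComplex_shortExact (d := d) hN).map_of_exact ((evaluation _ _).obj n)).exact
  rw [ShortComplex.ab_exact_iff] at h
  obtain ⟨z, hz⟩ := h x hx
  exact ⟨z, (zsmul_id_app_apply n z).symm.trans hz⟩

/-- A class annihilated by `N` comes from a morphism to `Sᵈ/N`, by the long exact sequence. -/
theorem exists_ext_of_zsmul_eq_zero (hN : N ≠ 0) {X : FunAb} (x : Ext X (symFunctor d) 1)
    (hx : N • x = 0) : ∃ φ : X ⟶ symQuot d N,
      (Ext.mk₀ φ).comp (mulComplex_shortExact hN).extClass (zero_add 1) = x := by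
  obtain ⟨y, hy⟩ := Ext.covariant_sequence_exact₁ X (mulComplex_shortExact (d := d) hN) x (by
    rw [ext_comp_mk₀_zsmul, Ext.comp_mk₀_id, hx]) (zero_add 1)
  obtain ⟨φ, rfl⟩ := (Ext.mk₀_bijective _ _).2 y
  exact ⟨φ, hy⟩

/-- Every morphism `I → Sᵈ/N` takes `e₁` to the class of a multiple of `e₁ᵈ`. -/
theorem exists_app_oneVec (φ : inclFunctor ⟶ symQuot d N) :
    ∃ c : ℤ, φ.app ⟨1⟩ oneVec = (symQuotπ d N).app ⟨1⟩ (c • onePow d) := by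
  obtain ⟨x, hx⟩ := funAb_epi_app_surjective (symQuotπ d N) ⟨1⟩ (φ.app ⟨1⟩ oneVec)
  obtain ⟨c, rfl⟩ := exists_zsmul_onePow d x
  exact ⟨c, hx.symm⟩

end MulSequence

/-- `p` annihilates `Hom(I, Sᵈ/N)`: a morphism sends `e₁` to the class of some `c e₁ᵈ`, and by
additivity `N` divides `c (d choose k)` for `0 < k < d`. -/
theorem p_smul_inclFunctor_hom {p l : ℕ} (hp : p.Prime) (hl : 1 ≤ l) {N : ℤ} (hN : N ≠ 0)
    (φ : inclFunctor ⟶ symQuot (p ^ l) N) : (p : ℤ) • φ = 0 := by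
  obtain ⟨c, hc⟩ := exists_app_oneVec φ
  have hadd := inclFunctor_hom_additive φ
  have hmap (v : Fin 2 → ℤ) : (symQuot (p ^ l) N).map (vecHom ⟨2⟩ v) (φ.app ⟨1⟩ oneVec) =
      (symQuotπ (p ^ l) N).app ⟨2⟩ (c • symPowOf (p ^ l) v : symPow (p ^ l) (Fin 2 → ℤ)) := by
    rw [hc, ← natTrans_app_apply]
    refine congrArg _ ?_
    exact (map_zsmul ((symFunctor (p ^ l)).map (vecHom ⟨2⟩ v)).hom c _).trans
      (congrArg _ (symFunctor_map_vecHom_onePow _ v))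
  rw [hmap, hmap, hmap] at hadd
  obtain ⟨z, hz⟩ := exists_zsmul_eq_of_symQuotπ_app_eq_zero hN ⟨2⟩
    (c • symPowOf (p ^ l) ![1, 1] - c • symPowOf (p ^ l) ![1, 0] - c • symPowOf (p ^ l) ![0, 1] :
      symPow (p ^ l) (Fin 2 → ℤ)) (by
      rw [← sub_eq_zero, ← sub_sub] at hadd
      refine Eq.trans ?_ hadd
      exact (map_sub ((symQuotπ (p ^ l) N).app ⟨2⟩).hom _ _).trans
        (congrArg (· - _) (map_sub ((symQuotπ (p ^ l) N).app ⟨2⟩).hom _ _)))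
  obtain ⟨r, hr⟩ := dvd_mul_prime_of_additive hp hl hz
  refine inclFunctor_hom_ext ?_
  rw [NatTrans.app_zsmul]
  change (p : ℤ) • φ.app ⟨1⟩ oneVec = 0
  rw [hc]
  have hg' : (symQuotπ (p ^ l) N).app ⟨1⟩ ((N • 𝟙 (symFunctor (p ^ l))).app ⟨1⟩
      (r • onePow (p ^ l))) = 0 :=
    congrArg (fun η : symFunctor (p ^ l) ⟶ symQuot (p ^ l) N => η.app ⟨1⟩ (r • onePow (p ^ l)))
      (zsmul_id_comp_symQuotπ (p ^ l) N)
  rw [zsmul_id_app_apply, smul_smul, ← hr] at hg'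
  refine Eq.trans ?_ hg'
  rw [mul_comm, mul_smul]
  exact (map_zsmul ((symQuotπ (p ^ l) N).app ⟨1⟩).hom (p : ℤ) _).symm

/-- `p` annihilates `Ext¹(I, Sᵈ)`: each class comes from a morphism `I → Sᵈ/N`, `N = 2ᵈ - 2`. -/
theorem p_smul_ext {p l : ℕ} (hp : p.Prime) (hl : 1 ≤ l)
    (x : Ext inclFunctor (symFunctor (p ^ l)) 1) : (p : ℤ) • x = 0 := by
  have hN : (2 : ℤ) ^ (p ^ l) - 2 ≠ 0 := by
    have h : 1 < p ^ l := Nat.one_lt_pow (by omega) hp.one_lt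
    have : (2 : ℤ) ^ 1 < 2 ^ (p ^ l) := pow_lt_pow_right₀ one_lt_two h
    rw [pow_one] at this
    omega
  obtain ⟨φ, rfl⟩ := exists_ext_of_zsmul_eq_zero hN x (ext_inclFunctor_symFunctor_torsion _ x)
  rw [← ext_mk₀_zsmul_comp, p_smul_inclFunctor_hom hp hl hN, Ext.mk₀_zero, Ext.zero_comp]

/-! ### The extension `E_d` and its class -/

section Extension

variable {p : ℕ} (hp : p.Prime) (l : ℕ)

/-- The inclusion `Sᵈ → E_d`. -/
noncomputable def frobExtensionInl : symFunctor (p ^ l) ⟶ frobExtension hp l where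
  app n := AddCommGrpCat.ofHom
    (AddMonoidHom.inl (symPow (p ^ l) (Fin n.rank → ℤ)) (Fin n.rank → ℤ))
  naturality m n f := by
    ext1
    refine DFunLike.ext _ _ fun x => ?_
    change (symPowMap (p ^ l) f x, (0 : Fin n.rank → ℤ)) =
      twistedHom (m := m.rank) (n := n.rank) (p ^ l) f (frobDefect hp l f) (x, 0)
    rw [twistedHom_apply, map_zero, add_zero, map_zero]

/-- The projection `E_d → I`. -/
noncomputable def frobExtensionSnd : frobExtension hp l ⟶ inclFunctor where
  app n := AddCommGrpCat.ofHom
    (AddMonoidHom.snd (symPow (p ^ l) (Fin n.rank → ℤ)) (Fin n.rank → ℤ))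
  naturality _ _ _ := rfl

theorem frobExtensionInl_comp_snd : frobExtensionInl hp l ≫ frobExtensionSnd hp l = 0 := rfl

/-- The sequence `Sᵈ → E_d → I`. -/
noncomputable abbrev frobComplex : ShortComplex FunAb :=
  .mk (frobExtensionInl hp l) (frobExtensionSnd hp l) (frobExtensionInl_comp_snd hp l)

/-- The inclusion `Sᵈ → E_d` is a kernel of the projection `E_d → I`. -/
theorem exists_frobExtensionInl_lift {W : FunAb} (k : W ⟶ frobExtension hp l)
    (hk : k ≫ frobExtensionSnd hp l = 0) :
    ∃ j : W ⟶ symFunctor (p ^ l), j ≫ frobExtensionInl hp l = k := by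
  have hsnd (n : FreeAb) (w : W.obj n) : (k.app n w : symPow (p ^ l) (Fin n.rank → ℤ) × _).2 = 0 :=
    congrArg (fun η : W ⟶ inclFunctor => η.app n w) hk
  refine ⟨⟨fun n => AddCommGrpCat.ofHom ((AddMonoidHom.fst (symPow (p ^ l) (Fin n.rank → ℤ))
    (Fin n.rank → ℤ)).comp (k.app n).hom), fun m n f => ?_⟩, ?_⟩
  · ext1
    refine DFunLike.ext _ _ fun w => ?_
    have h1 := congrArg Prod.fst (natTrans_app_apply k f w)
    refine h1.trans ?_
    change symPowMap (p ^ l) f _ + frobDefect hp l f (k.app m w : symPow (p ^ l) _ × _).2 = _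
    rw [hsnd, map_zero, add_zero]
    rfl
  · ext1; ext1 n; ext1
    refine DFunLike.ext _ _ fun w => ?_
    exact Prod.ext rfl (hsnd n w).symm

theorem frobComplex_shortExact : (frobComplex hp l).ShortExact where
  exact := by
    rw [ShortComplex.exact_iff_exact_up_to_refinements]
    intro W k hk
    obtain ⟨j, hj⟩ := exists_frobExtensionInl_lift hp l k hk
    exact ⟨W, 𝟙 W, inferInstance, j, by rw [hj, Category.id_comp]⟩
  mono_f := by
    have : ∀ n, Mono ((frobExtensionInl hp l).app n) := by
      intro n
      rw [AddCommGrpCat.mono_iff_injective]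
      exact fun x y h => congrArg Prod.fst h
    exact NatTrans.mono_of_mono_app _
  epi_g := by
    have : ∀ n, Epi ((frobExtensionSnd hp l).app n) := by
      intro n
      rw [AddCommGrpCat.epi_iff_surjective]
      exact fun v => ⟨((0, v) : symPow (p ^ l) (Fin n.rank → ℤ) × (Fin n.rank → ℤ)), rfl⟩
    exact NatTrans.epi_of_epi_app _

/-- The natural transformation `E_d → Sᵈ`, `(x, v) ↦ p x + θ(v)`, where `θ` is `frobLift`. -/
noncomputable def frobExtensionDesc : frobExtension hp l ⟶ symFunctor (p ^ l) where
  app n := AddCommGrpCat.ofHom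
    (((p : ℤ) • AddMonoidHom.id (symPow (p ^ l) (Fin n.rank → ℤ))).coprod
      (frobLift (p ^ l) n.rank))
  naturality m n f := by
    ext1
    refine DFunLike.ext _ _ fun x => ?_
    change (p : ℤ) • (symPowMap (p ^ l) f x.1 + frobDefect hp l f x.2) +
      frobLift (p ^ l) n.rank ((show (Fin m.rank → ℤ) →+ (Fin n.rank → ℤ) from f) x.2) =
      symPowMap (p ^ l) f ((p : ℤ) • x.1 + frobLift (p ^ l) m.rank x.2)
    rw [smul_add, p_smul_frobDefect, map_add, map_zsmul]
    abel

/-- The extension `E_d` is the pullback of `0 → Sᵈ → Sᵈ → Sᵈ/p → 0` along the Frobenius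
`I → Sᵈ/p`, which takes `e₁` to the class of `e₁ᵈ`. -/
theorem exists_frobenius_extClass : ∃ φ : inclFunctor ⟶ symQuot (p ^ l) p,
    φ.app ⟨1⟩ oneVec = (symQuotπ (p ^ l) p).app ⟨1⟩ (onePow (p ^ l)) ∧
    (Ext.mk₀ φ).comp (mulComplex_shortExact (d := p ^ l)
      (Int.natCast_ne_zero.2 hp.ne_zero)).extClass (zero_add 1) =
      (frobComplex_shortExact hp l).extClass := by
  have hS := frobComplex_shortExact hp l
  have := hS.epi_g
  have hdesc : frobExtensionInl hp l ≫ frobExtensionDesc hp l = (p : ℤ) • 𝟙 _ := by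
    ext n x
    rw [zsmul_id_app_apply]
    exact (congrArg (_ + ·) (map_zero (frobLift (p ^ l) n.rank))).trans (add_zero _)
  have h0 : frobExtensionInl hp l ≫ frobExtensionDesc hp l ≫ symQuotπ (p ^ l) p = 0 := by
    rw [← Category.assoc, hdesc, zsmul_id_comp_symQuotπ]
  let φ : inclFunctor ⟶ symQuot (p ^ l) p := hS.exact.desc _ h0
  have hφ : frobExtensionSnd hp l ≫ φ = frobExtensionDesc hp l ≫ symQuotπ (p ^ l) p :=
    hS.exact.g_desc _ h0
  refine ⟨φ, ?_, ?_⟩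
  · let e : (frobExtension hp l).obj ⟨1⟩ :=
      ((0, fun _ => 1) : symPow (p ^ l) (Fin 1 → ℤ) × (Fin 1 → ℤ))
    have h := congrArg (fun η : frobExtension hp l ⟶ symQuot (p ^ l) p => η.app ⟨1⟩ e) hφ
    refine h.trans (congrArg ((symQuotπ (p ^ l) p).app ⟨1⟩) ?_)
    change (p : ℤ) • (0 : symPow (p ^ l) (Fin 1 → ℤ)) + frobLift (p ^ l) 1 (fun _ => 1) =
      symPowOf (p ^ l) (fun _ => 1)
    rw [smul_zero, zero_add, frobLift_one]
  · let s : frobComplex hp l ⟶ mulComplex (p ^ l) p :=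
      { τ₁ := 𝟙 _
        τ₂ := frobExtensionDesc hp l
        τ₃ := φ
        comm₁₂ := (Category.id_comp _).trans hdesc.symm
        comm₂₃ := hφ.symm }
    have h := hS.extClass_naturality (mulComplex_shortExact (d := p ^ l)
      (Int.natCast_ne_zero.2 hp.ne_zero)) s
    refine h.symm.trans ?_
    exact Ext.comp_mk₀_id _

variable {l}

/-- The class of `E_d` generates `Ext¹(I, Sᵈ)`: every morphism `I → Sᵈ/p` is a multiple of the
Frobenius. -/
theorem exists_zsmul_extClass (hl : 1 ≤ l) (x : Ext inclFunctor (symFunctor (p ^ l)) 1) :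
    ∃ k : ℤ, k • ((frobComplex_shortExact hp l).extClass :
      Ext inclFunctor (symFunctor (p ^ l)) 1) = x := by
  obtain ⟨φ, hφ, hE⟩ := exists_frobenius_extClass hp l
  obtain ⟨ψ, rfl⟩ := exists_ext_of_zsmul_eq_zero (Int.natCast_ne_zero.2 hp.ne_zero) x
    (p_smul_ext hp hl x)
  obtain ⟨c, hc⟩ := exists_app_oneVec ψ
  have h : ψ = c • φ := by
    refine inclFunctor_hom_ext ?_
    rw [NatTrans.app_zsmul]
    change _ = c • φ.app ⟨1⟩ oneVec
    rw [hc, hφ]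
    exact map_zsmul ((symQuotπ (p ^ l) p).app ⟨1⟩).hom c _
  refine ⟨c, ?_⟩
  rw [h, ext_mk₀_zsmul_comp]
  exact congrArg (c • ·) hE.symm

/-- The projection `E_d → I` has no section: a section would take `e₁` to some `(c e₁ᵈ, e₁)`, and
additivity would give `(p c + 1) ((e₁ + e₂)ᵈ - e₁ᵈ - e₂ᵈ) = 0`. -/
theorem frobExtensionSnd_no_section (hl : 1 ≤ l) (s : inclFunctor ⟶ frobExtension hp l) :
    s ≫ frobExtensionSnd hp l ≠ 𝟙 inclFunctor := by
  intro hs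
  have hsnd : (s.app ⟨1⟩ oneVec : symPow (p ^ l) (Fin 1 → ℤ) × (Fin 1 → ℤ)).2 = fun _ => 1 :=
    congrArg (fun η : inclFunctor ⟶ inclFunctor => η.app ⟨1⟩ oneVec) hs
  obtain ⟨c, hc⟩ := exists_zsmul_onePow (p ^ l)
    (s.app ⟨1⟩ oneVec : symPow (p ^ l) (Fin 1 → ℤ) × (Fin 1 → ℤ)).1
  have hx : (s.app ⟨1⟩ oneVec : symPow (p ^ l) (Fin 1 → ℤ) × (Fin 1 → ℤ)) =
      (c • symPowOf (p ^ l) (fun _ => 1), fun _ => 1) := Prod.ext hc hsnd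
  have hmap (v : Fin 2 → ℤ) :
      (p : ℤ) • ((frobExtension hp l).map (vecHom ⟨2⟩ v) (s.app ⟨1⟩ oneVec) :
        symPow (p ^ l) (Fin 2 → ℤ) × (Fin 2 → ℤ)).1 =
      ((c * p + 1) • symPowOf (p ^ l) v - frobLift (p ^ l) 2 v : symPow (p ^ l) (Fin 2 → ℤ)) := by
    let f : (Fin 1 → ℤ) →+ (Fin 2 → ℤ) := vecHom ⟨2⟩ v
    have hf : f (fun _ => 1) = v := inclFunctor_map_vecHom ⟨2⟩ v
    have h1 : ((frobExtension hp l).map (vecHom ⟨2⟩ v) (s.app ⟨1⟩ oneVec) :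
        symPow (p ^ l) (Fin 2 → ℤ) × (Fin 2 → ℤ)) =
        twistedHom (p ^ l) f (frobDefect hp l f) (c • symPowOf (p ^ l) (fun _ => 1), fun _ => 1) :=
      congrArg (twistedHom (p ^ l) f (frobDefect hp l f)) hx
    rw [h1, twistedHom_apply, smul_add, p_smul_frobDefect, frobLift_one, map_zsmul,
      symPowMap_symPowOf, hf, smul_smul, add_smul, one_smul, mul_comm, add_sub_assoc]
  have hadd := congrArg (fun x : symPow (p ^ l) (Fin 2 → ℤ) × (Fin 2 → ℤ) => (p : ℤ) • x.1)
    (inclFunctor_hom_additive s)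
  have hadd' := (hmap _).symm.trans (hadd.trans ((smul_add (p : ℤ) _ _).trans
    (congrArg₂ (· + ·) (hmap _) (hmap _))))
  have h11 : frobLift (p ^ l) 2 ![1, 1] =
      frobLift (p ^ l) 2 ![1, 0] + frobLift (p ^ l) 2 ![0, 1] := by
    rw [← map_add]
    congr 1
    funext i; fin_cases i <;> rfl
  -- divisibility by `N = 0` says that `(c p + 1) p` vanishes
  have hdvd := dvd_mul_prime_of_additive hp hl (N := 0) (c := c * p + 1) (z := 0) (by
    rw [h11, sub_eq_iff_eq_add] at hadd'
    rw [hadd', smul_zero]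
    abel)
  have h0 := (mul_eq_zero.1 (zero_dvd_iff.1 hdvd)).resolve_right (Int.natCast_ne_zero.2 hp.ne_zero)
  have hp2 : (p : ℤ) ∣ 1 := ⟨-c, by linarith⟩
  exact hp.one_lt.ne' (Nat.dvd_one.1 (Int.natCast_dvd_natCast.1 hp2))

theorem frobComplex_extClass_ne_zero (hl : 1 ≤ l) :
    ((frobComplex_shortExact hp l).extClass : Ext inclFunctor (symFunctor (p ^ l)) 1) ≠ 0 := by
  intro h
  obtain ⟨y, hy⟩ := Ext.covariant_sequence_exact₃ inclFunctor (frobComplex_shortExact hp l)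
    (Ext.mk₀ (𝟙 inclFunctor)) (zero_add 1) ((Ext.mk₀_id_comp _).trans h)
  obtain ⟨s, rfl⟩ := (Ext.mk₀_bijective _ _).2 y
  rw [Ext.mk₀_comp_mk₀] at hy
  exact frobExtensionSnd_no_section hp hl s ((Ext.mk₀_bijective _ _).1 hy)

end Extension

theorem nonempty_ext_addEquiv {p : ℕ} (hp : p.Prime) {l : ℕ} (hl : 1 ≤ l) :
    Nonempty (Ext inclFunctor (symFunctor (p ^ l)) 1 ≃+ ZMod p) := by
  let β : Ext inclFunctor (symFunctor (p ^ l)) 1 := (frobComplex_shortExact hp l).extClass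
  have hgen : ∀ x, x ∈ AddSubgroup.zmultiples β := exists_zsmul_extClass hp hl
  have hcyc : IsAddCyclic (Ext inclFunctor (symFunctor (p ^ l)) 1) := ⟨β, hgen⟩
  have : Fact p.Prime := ⟨hp⟩
  have hord : addOrderOf β = p := addOrderOf_eq_prime
    (by rw [← natCast_zsmul]; exact p_smul_ext hp hl β) (frobComplex_extClass_ne_zero hp hl)
  have hcard : Nat.card (Ext inclFunctor (symFunctor (p ^ l)) 1) = p := by
    exact (addOrderOf_eq_card_of_forall_mem_zmultiples hgen).symm.trans hord
  have e := zmodAddCyclicAddEquiv hcyc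
  rw [hcard] at e
  exact ⟨e.symm⟩

theorem proposition202508041518 (p l : ℕ) (hp : p.Prime) (hl : 1 ≤ l) :
    ∃ (E : FunAb) (hE : gammaToAb ⋙ E = twistedFunctor p l),
      (∀ F : FunAb, gammaToAb ⋙ F = twistedFunctor p l → F = E) ∧
      ∃ (i : symFunctor (p ^ l) ⟶ E) (q : E ⟶ inclFunctor) (w : i ≫ q = 0)
        (hS : (ShortComplex.mk i q w).ShortExact),
        (∀ a : CGamma, i.app (gammaToAb.obj a) ≫ eqToHom (Functor.congr_obj hE a) =
          AddCommGrpCat.ofHom (AddMonoidHom.inl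
            (symPow (p ^ l) (Fin (gammaToAb.obj a).rank → ℤ))
            (Fin (gammaToAb.obj a).rank → ℤ))) ∧
        (∀ a : CGamma, eqToHom (Functor.congr_obj hE a).symm ≫ q.app (gammaToAb.obj a) =
          AddCommGrpCat.ofHom (AddMonoidHom.snd
            (symPow (p ^ l) (Fin (gammaToAb.obj a).rank → ℤ))
            (Fin (gammaToAb.obj a).rank → ℤ))) ∧
        IsEmpty (ShortComplex.mk i q w).Splitting ∧
        (∀ x : Ext inclFunctor (symFunctor (p ^ l)) 1,
          x ∈ AddSubgroup.zmultiples (hS.extClass : Ext inclFunctor (symFunctor (p ^ l)) 1)) ∧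
        Nonempty (Ext inclFunctor (symFunctor (p ^ l)) 1 ≃+ ZMod p) := by
  have hE := gammaToAb_comp_frobExtension hp hl
  refine ⟨frobExtension hp l, hE, fun F hF => eq_of_gammaToAb_comp_eq (hF.trans hE.symm),
    frobExtensionInl hp l, frobExtensionSnd hp l, frobExtensionInl_comp_snd hp l,
    frobComplex_shortExact hp l, fun a => Category.comp_id _, fun a => Category.id_comp _,
    ⟨fun σ => frobExtensionSnd_no_section hp hl σ.s σ.s_g⟩, exists_zsmul_extClass hp hl,
    nonempty_ext_addEquiv hp hl⟩
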